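/- Let $K$ be a field of characteristic $0$ (for instance $K=\mathbb{Q}(l,r)\subset\mathbb{C}$ for complex numbers $l,r$) and let $l,r\in K$ be nonzero with $r^{2k}\notin\{1,-1\}$ for $k=1,2,3$ and $r^8\neq 1$ (so that the Hecke algebras of $D_4$ and of $\mathrm{Sym}(4)$ with parameter $r^2$ are semisimple). Put $m=\frac1r-r$. Number the nodes of the Dynkin diagram $D_4$ so that $1,2,4$ are each joined to $3$. Let $V_4$ be the Cohen–Wales representation: the $12$-dimensional $K$-representation of the CGW (Birman–Murakami–Wenzl type) algebra of type $D_4$ with generators $g_1,\dots,g_4$ and $e_i=\frac lm(g_i^2+mg_i-1)$ (braid relations of type $D_4$, $g_ie_i=l^{-1}e_i$, and $e_ig_je_i=l\,e_i$ for adjacent $i,j$), with basis $w_{ij},\widehat{w_{ij}}$ ($1\le i<j\le4$). Here $\widehat{w_{12}},w_{12},w_{23},w_{34}$ span the lines $e_1V_4,e_2V_4,e_3V_4,e_4V_4$ respectively; $g_1,g_4$ act on $w_{12}$, $g_2,g_4$ on $\widehat{w_{12}}$ and $g_1,g_2$ on $w_{34}$ by multiplication by $r$; and $g_{j+1}w_{ij}=w_{i,j+1}$,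 $g_{i+1}w_{ij}=w_{i+1,j}$ for $i+1<j$, likewise for the $\widehat{w_{ij}}$, and $g_1\widehat{w_{13}}=w_{23}$. A subspace is invariant if it is stable under all $g_i$. Let $\mathcal H(D_4)$ be the Hecke algebra with generators $g_1,\dots,g_4$, the braid relations of type $D_4$ and $g_i^2+mg_i=1$. For a double partition $(\lambda,\mu)$ of $4$ let $S^{\lambda,\mu}$ be its Specht module, that is, the irreducible module of the Hecke algebra of type $B_4$ labelled by $(\lambda,\mu)$ (generators $g_0,g_2,g_3,g_4$, $g_0^2=1$, with $g_i=r$ for $i\ge 2$ on the module of $(\emptyset,(4))$) restricted to $\mathcal H(D_4)$ by $g_1=g_0g_2g_0$; $S^{\lambda,\lambda}$ is the direct sum of two irreducible modules $S^{(\lambda,\lambda)+}$ and $S^{(\lambda,\lambda)-}$, the eigenspaces of the involution exchanging the two components. A Specht module occurs in $V_4$ if some invariant subspace of $V_4$ is isomorphic to it (by a linear isomorphism commuting with all $g_i$). Then: (i) $V_4$ has an irreducible $3$-dimensional invariant subspace isomorphic to $S^{(2,2)+}$ (resp. $S^{(2,2)-}$) if and only if $l=\frac1r$; and if $l=\frac1r$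 this subspace is unique. Moreover, if $l=\frac1r$, the span of the vectors $t_{ij}=w_{ij}-\widehat{w_{ij}}$, $1\le i<j\le4$, is a $6$-dimensional invariant subspace and is the direct sum of the two irreducible $3$-dimensional invariant subspaces $\mathcal U$ and $\mathcal W$ spanned respectively by $$u_1=m\,t_{12}+t_{13}+t_{24},\quad u_2=(1-r^2)t_{12}+t_{23}+t_{14}-m\,t_{24},\quad u_3=t_{12}+t_{34},$$ $$w_1=-t_{13}+m\,t_{23}+t_{24},\quad w_2=-t_{12}+m\,t_{13}+(1-r^2)t_{23}+t_{34},\quad w_3=-t_{23}+t_{14}.$$ (ii) The Specht modules $S^{(1^2,1^2)+}$ and $S^{(1^2,1^2)-}$ do not occur in $V_4$. (iii) The Specht module $S^{(1,1),(2)}$ does not occur in $V_4$. -/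

import Mathlib

/-! ### Invariant subspaces for a finite family of operators -/

/-- `W` is stable under all the operators `g i`. -/
def IsInvariantSubspace {ι K V : Type*} [Field K] [AddCommGroup V] [Module K V]
    (g : ι → Module.End K V) (W : Submodule K V) : Prop :=
  ∀ i, ∀ v ∈ W, g i v ∈ W

/-- `W` is a nonzero invariant subspace whose only invariant subspaces are `0` and `W`. -/
def IsIrreducibleSubspace {ι K V : Type*} [Field K] [AddCommGroup V] [Module K V]
    (g : ι → Module.End K V) (W : Submodule K V) : Prop :=
  IsInvariantSubspace g W ∧ W ≠ ⊥ ∧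
    ∀ W' : Submodule K V, W' ≤ W → IsInvariantSubspace g W' → W' = ⊥ ∨ W' = W

/-- The subspace `W` of `V`, invariant under the operators `g i`, and the subspace `S` of `M`,
invariant under the operators `h i`, are isomorphic: there is a linear isomorphism `W ≃ S` that
carries the action of each `g i` to the action of `h i`. -/
def AreIsomorphicSubspaces {ι K V M : Type*} [Field K] [AddCommGroup V] [Module K V]
    [AddCommGroup M] [Module K M] (g : ι → Module.End K V) (W : Submodule K V)
    (h : ι → Module.End K M) (S : Submodule K M) : Prop :=
  IsInvariantSubspace g W ∧ IsInvariantSubspace h S ∧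
    ∃ φ : W ≃ₗ[K] S, ∀ (i : ι) (v w : W), (w : V) = g i (v : V) → (φ w : M) = h i (φ v : M)

/-! ### The Cohen-Wales representation of type `D₄` -/

/-- The twelve basis vectors of the Cohen-Wales space of type `D₄`; `w i j` is written `wij` and
`ŵ i j` is written `hij`, for `1 ≤ i < j ≤ 4`. -/
inductive CWIndex : Type
  | w12 | w13 | w14 | w23 | w24 | w34
  | h12 | h13 | h14 | h23 | h24 | h34
  deriving DecidableEq

instance : Fintype CWIndex where
  elems := {.w12, .w13, .w14, .w23, .w24, .w34, .h12, .h13, .h14, .h23, .h24, .h34}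
  complete b := by cases b <;> decide

/-- The Cohen-Wales space `V₄`, of dimension 12. -/
abbrev CWSpace (K : Type*) : Type _ := CWIndex → K

namespace CohenWales

variable {K : Type*} [Field K]

/-- The basis vector of `V₄` with the given label. -/
def x (b : CWIndex) : CWSpace K := Pi.single b 1

/-- The parameter `m = 1 / r - r`. -/
def m (r : K) : K := r⁻¹ - r

/-- Images of the basis vectors under `g₁`. The nodes `1` and `2` of the Dynkin diagram `D₄` are
both joined to the node `3`, as is the node `4`, and `ŵ₁₂, w₁₂, w₂₃, w₃₄` are the
vectors that belong to the nodes `1, 2, 3, 4`. The other basis vectors are obtained from these by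
`g_{j+1} w_{ij} = w_{i,j+1}` and `g_{i+1} w_{ij} = w_{i+1,j}` (if `i + 1 < j`), and likewise for the
`ŵ_{ij}`; moreover `g₁ ŵ₁₃ = w₂₃`. -/
def image₁ (l r : K) : CWIndex → CWSpace K
  | .w12 => r • x .w12
  | .w13 => x .h23 - m r • x .w13 + m r • x .h13 - (m r * r⁻¹) • x .w12 + (m r * r⁻¹) • x .h12
  | .w14 => x .h24 - m r • x .w14 + m r • x .h14 - m r • x .w12 + m r • x .h12
  | .w23 => x .h13 - m r • x .w23 + m r • x .h12
  | .w24 => x .h14 - m r • x .w24 + (m r * r) • x .h12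
  | .w34 => r • x .w34
  | .h12 => l⁻¹ • x .h12
  | .h13 => x .w23
  | .h14 => x .w24
  | .h23 => x .w13 - m r • x .w23 + m r • x .w12
  | .h24 => x .w14 - m r • x .w24 + (m r * r) • x .w12
  | .h34 => r • x .h34 + (m r * r) • (x .h24 - x .w24) + m r • (x .h23 - x .w23)
      + m r • (x .h14 - x .w14) + (m r * r⁻¹) • (x .h13 - x .w13)
      + (m r ^ 2 * (r + r⁻¹)) • (x .h12 - x .w12)

/-- Images of the basis vectors under `g₂`. -/
def image₂ (l r : K) : CWIndex → CWSpace K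
  | .w12 => l⁻¹ • x .w12
  | .w13 => x .w23
  | .w14 => x .w24
  | .w23 => x .w13 - m r • x .w23 + m r • x .w12
  | .w24 => x .w14 - m r • x .w24 + (m r * r) • x .w12
  | .w34 => r • x .w34
  | .h12 => r • x .h12
  | .h13 => x .h23
  | .h14 => x .h24
  | .h23 => x .h13 - m r • x .h23 + (m r * l⁻¹ * r⁻¹) • x .w12
  | .h24 => x .h14 - m r • x .h24 + (m r * l⁻¹) • x .w12
  | .h34 => r • x .h34

/-- Images of the basis vectors under `g₃`. -/
def image₃ (l r : K) : CWIndex → CWSpace K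
  | .w12 => x .w13
  | .w13 => x .w12 - m r • x .w13 + (m r * l⁻¹) • x .w23
  | .w14 => r • x .w14
  | .w23 => l⁻¹ • x .w23
  | .w24 => x .w34
  | .w34 => x .w24 - m r • x .w34 + m r • x .w23
  | .h12 => x .h13
  | .h13 => x .h12 - m r • x .h13 + (m r * l⁻¹) • x .w23
  | .h14 => r • x .h14
  | .h23 => r • x .h23
  | .h24 => x .h34
  | .h34 => x .h24 - m r • x .h34 + (m r * l⁻¹ * r⁻¹) • x .w23

/-- Images of the basis vectors under `g₄`. -/
def image₄ (l r : K) : CWIndex → CWSpace K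
  | .w12 => r • x .w12
  | .w13 => x .w14
  | .w14 => x .w13 - m r • x .w14 + (m r * l⁻¹ * r⁻¹) • x .w34
  | .w23 => x .w24
  | .w24 => x .w23 - m r • x .w24 + (m r * l⁻¹) • x .w34
  | .w34 => l⁻¹ • x .w34
  | .h12 => r • x .h12
  | .h13 => x .h14
  | .h14 => x .h13 - m r • x .h14 + (m r * l⁻¹ * r⁻¹) • x .w34
  | .h23 => x .h24
  | .h24 => x .h23 - m r • x .h24 + (m r * l⁻¹) • x .w34
  | .h34 => r • x .h34

/-- The operators `g₁, g₂, g₃, g₄` (indexed by `0, 1, 2, 3`) of the Cohen-Wales representation on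
`V₄`. The remaining generators `eᵢ = (l / m) (gᵢ² + m gᵢ - 1)` of the CGW algebra are polynomials in
the `gᵢ`, so a subspace is invariant under the algebra if and only if it is invariant under the
four operators `gᵢ`. The relations of the algebra are verified below. -/
def g (l r : K) : Fin 4 → Module.End K (CWSpace K) :=
  ![Fintype.linearCombination K (image₁ l r), Fintype.linearCombination K (image₂ l r),
    Fintype.linearCombination K (image₃ l r), Fintype.linearCombination K (image₄ l r)]

/-- The operators `eᵢ = (l / m) (gᵢ² + m gᵢ - 1)`. -/
def e (l r : K) (i : Fin 4) : Module.End K (CWSpace K) :=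
  (l / m r) • (g l r i * g l r i + m r • g l r i - 1)

/-- The label of the vector that belongs to the `i`-th node of the Dynkin diagram. -/
def node : Fin 4 → CWIndex := ![.h12, .w12, .w23, .w34]

theorem g_apply_x (l r : K) (b : CWIndex) :
    g l r 0 (x b) = image₁ l r b ∧ g l r 1 (x b) = image₂ l r b ∧
      g l r 2 (x b) = image₃ l r b ∧ g l r 3 (x b) = image₄ l r b := by
  simp [g, x, Fintype.linearCombination_apply_single]

theorem end_ext {f h : Module.End K (CWSpace K)} (H : ∀ b, f (x b) = h (x b)) : f = h := by
  apply LinearMap.pi_ext'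
  intro b
  ext
  simpa [x] using congrFun (H b) _

/-- The operators satisfy the braid relations of type `D₄`. -/
theorem braid_relations (l r : K) (hl : l ≠ 0) (hr : r ≠ 0) :
    g l r 0 * g l r 1 = g l r 1 * g l r 0 ∧
    g l r 0 * g l r 3 = g l r 3 * g l r 0 ∧
    g l r 1 * g l r 3 = g l r 3 * g l r 1 ∧
    ∀ i ∈ ({0, 1, 3} : Set (Fin 4)), g l r i * g l r 2 * g l r i = g l r 2 * g l r i * g l r 2 := by
  refine ⟨?_, ?_, ?_, ?_⟩
  on_goal 4 => rintro i (rfl | rfl | rfl)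
  all_goals
    apply end_ext
    intro b
    cases b <;> simp only [Module.End.mul_apply, g_apply_x, image₁, image₂, image₃, image₄,
      map_add, map_sub, map_smul] <;> match_scalars <;> (try simp only [m]) <;> field_simp <;> ring

theorem quadratic_apply (l r : K) (hl : l ≠ 0) (hr : r ≠ 0) (i : Fin 4) (b : CWIndex) :
    ∃ c : K, g l r i (g l r i (x b)) + m r • g l r i (x b) - x b = c • x (node i) := by
  obtain rfl | rfl | rfl | rfl : i = 0 ∨ i = 1 ∨ i = 2 ∨ i = 3 := by fin_cases i <;> simp
  on_goal 1 => use match b with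
    | .h12 => l⁻¹ ^ 2 + m r * l⁻¹ - 1 | .h13 => m r | .h14 => m r * r
    | .h23 => m r * r | .h24 => m r * r ^ 2 | .h34 => m r ^ 2 * (r + r⁻¹) * (l⁻¹ - r)
    | .w12 => 0 | .w13 => m r * l⁻¹ * r⁻¹ | .w14 => m r * l⁻¹
    | .w23 => m r * l⁻¹ | .w24 => m r * r * l⁻¹ | .w34 => 0
  on_goal 2 => use match b with
    | .w12 => l⁻¹ ^ 2 + m r * l⁻¹ - 1 | .w13 => m r | .w14 => m r * r
    | .w23 => m r * l⁻¹ | .w24 => m r * r * l⁻¹ | .w34 => 0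
    | .h12 => 0 | .h13 => m r * l⁻¹ * r⁻¹ | .h14 => m r * l⁻¹
    | .h23 => m r * l⁻¹ ^ 2 * r⁻¹ | .h24 => m r * l⁻¹ ^ 2 | .h34 => 0
  on_goal 3 => use match b with
    | .w12 => m r * l⁻¹ | .w13 => m r * l⁻¹ ^ 2 | .w14 => 0
    | .w23 => l⁻¹ ^ 2 + m r * l⁻¹ - 1 | .w24 => m r | .w34 => m r * l⁻¹
    | .h12 => m r * l⁻¹ | .h13 => m r * l⁻¹ ^ 2 | .h14 => 0
    | .h23 => 0 | .h24 => m r * l⁻¹ * r⁻¹ | .h34 => m r * l⁻¹ ^ 2 * r⁻¹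
  on_goal 4 => use match b with
    | .w12 => 0 | .w13 => m r * l⁻¹ * r⁻¹ | .w14 => m r * l⁻¹ ^ 2 * r⁻¹
    | .w23 => m r * l⁻¹ | .w24 => m r * l⁻¹ ^ 2 | .w34 => l⁻¹ ^ 2 + m r * l⁻¹ - 1
    | .h12 => 0 | .h13 => m r * l⁻¹ * r⁻¹ | .h14 => m r * l⁻¹ ^ 2 * r⁻¹
    | .h23 => m r * l⁻¹ | .h24 => m r * l⁻¹ ^ 2 | .h34 => 0
  all_goals
    cases b <;> simp only [g_apply_x, image₁, image₂, image₃, image₄, map_add, map_sub, map_smul,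
      node, Matrix.cons_val] <;>
      match_scalars <;> (try simp only [m]) <;> field_simp <;> ring

theorem e_apply (l r : K) (hl : l ≠ 0) (hr : r ≠ 0) (i : Fin 4) (b : CWIndex) :
    ∃ c : K, e l r i (x b) = c • x (node i) := by
  obtain ⟨c, hc⟩ := quadratic_apply l r hl hr i b
  refine ⟨l / m r * c, ?_⟩
  rw [mul_smul, ← hc]
  simp [e]

/-- The relations `gᵢ eᵢ = l⁻¹ eᵢ` of the CGW algebra. -/
theorem g_mul_e (l r : K) (hl : l ≠ 0) (hr : r ≠ 0) (i : Fin 4) :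
    g l r i * e l r i = l⁻¹ • e l r i := by
  apply end_ext
  intro b
  obtain ⟨c, hc⟩ := e_apply l r hl hr i b
  rw [Module.End.mul_apply, LinearMap.smul_apply, hc, map_smul, smul_comm]
  congr 1
  fin_cases i <;> simp [g_apply_x, node, image₁, image₂, image₃, image₄]

/-- The relations `eᵢ gⱼ eᵢ = l eᵢ`, for adjacent nodes `i` and `j`, of the CGW algebra. -/
theorem e_mul_g_mul_e (l r : K) (hl : l ≠ 0) (hr : r ≠ 0) (hm : m r ≠ 0) (i j : Fin 4)
    (hij : i ≠ j) (hadj : i = 2 ∨ j = 2) :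
    e l r i * g l r j * e l r i = l • e l r i := by
  have key : g l r i (g l r i (g l r j (x (node i)))) + m r • g l r i (g l r j (x (node i)))
      - g l r j (x (node i)) = m r • x (node i) := by
    obtain ⟨rfl, rfl⟩ | ⟨rfl, rfl⟩ | ⟨rfl, rfl⟩ | ⟨rfl, rfl⟩ | ⟨rfl, rfl⟩ | ⟨rfl, rfl⟩ :
        i = 2 ∧ j = 0 ∨ i = 2 ∧ j = 1 ∨ i = 2 ∧ j = 3 ∨ i = 0 ∧ j = 2 ∨ i = 1 ∧ j = 2 ∨
          i = 3 ∧ j = 2 := by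
      revert i j; decide
    all_goals
      simp only [g_apply_x, image₁, image₂, image₃, image₄, map_add, map_sub, map_smul,
        node, Matrix.cons_val]
      match_scalars <;> (try simp only [m]) <;> field_simp <;> ring
  have key' : e l r i (g l r j (x (node i))) = l • x (node i) := by
    have : e l r i (g l r j (x (node i))) = (l / m r) • (m r • x (node i)) := by
      rw [← key]; simp [e]
    rw [this, smul_smul, div_mul_cancel₀ _ hm]
  apply end_ext
  intro b
  obtain ⟨c, hc⟩ := e_apply l r hl hr i b
  simp only [Module.End.mul_apply, LinearMap.smul_apply, hc, map_smul, key']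
  rw [smul_comm]

end CohenWales

/-! ### Specht modules of the Hecke algebra of type `D₄`

The Hecke algebra `H(D₄)` with parameter `r²` has generators `g₁, g₂, g₃, g₄` subject to the braid
relations of type `D₄` and to `gᵢ² + m gᵢ = 1`, so that `gᵢ` has eigenvalues `r` and `-1 / r`.
In the semisimple case the Specht module of a double partition is given by Young's (Hoefsmit's)
seminormal form: this is the irreducible module of the Hecke algebra of type `B₄` with generators
`g₀, g₂, g₃, g₄`, where `g₀² = 1`, restricted to `H(D₄)` through `g₁ = g₀ g₂ g₀`. -/

namespace Specht

/-- A box of a double Young diagram: the component (`false` is the first one), row, column. -/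
abbrev Box : Type := Bool × ℕ × ℕ

/-- A double partition, as a pair of Young diagrams. -/
abbrev DoublePartition : Type := YoungDiagram × YoungDiagram

/-- The box belongs to the double diagram. -/
def InDiagram (D : DoublePartition) (c : Box) : Prop :=
  c.2 ∈ (if c.1 then D.2 else D.1)

/-- `t` puts the entries `0, 1, 2, 3` into the boxes of the double diagram `D`, filling all of them,
such that in each component the entries increase along rows and down columns (the last condition
includes that different entries are in different boxes). -/
def IsStandard (D : DoublePartition) (t : Fin 4 → Box) : Prop :=
  (∀ k, InDiagram D (t k)) ∧ (∀ c, InDiagram D c → ∃ k, t k = c) ∧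
    ∀ k k', (t k).1 = (t k').1 → (t k).2.1 ≤ (t k').2.1 → (t k).2.2 ≤ (t k').2.2 → k ≤ k'

/-- Standard double tableaux of shape `D` with four entries. -/
abbrev Tableau (D : DoublePartition) : Type := {t : Fin 4 → Box // IsStandard D t}

/-- The space of the Specht module, with basis the standard double tableaux of shape `D`. -/
abbrev Space (K : Type*) [Field K] (D : DoublePartition) : Type _ := Tableau D →₀ K

section

variable {K : Type*} [Field K]

/-- The eigenvalue of `g₀`: it is `1` on the first component and `-1` on the second one. -/
def sign (K : Type*) [Field K] (c : Box) : K := if c.1 then -1 else 1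

/-- The content `± r ^ (2 (column - row))` of a box. -/
def content (r : K) (c : Box) : K := sign K c * r ^ (2 * ((c.2.2 : ℤ) - (c.2.1 : ℤ)))

/-- The basis vector of `t`, or zero if `t` is not standard. -/
noncomputable def vec (K : Type*) [Field K] (D : DoublePartition) (t : Fin 4 → Box) : Space K D :=
  open Classical in if h : IsStandard D t then Finsupp.single ⟨t, h⟩ 1 else 0

/-- The diagonal coefficient at `t` of the operator that exchanges the entries `k` and `k + 1`. -/
noncomputable def diagCoeff (r : K) (t : Fin 4 → Box) (k : Fin 3) : K :=
  (r - r⁻¹) / (1 - content r (t k.castSucc) / content r (t k.succ))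

/-- The operator that exchanges `k` and `k + 1` (`g₂, g₃, g₄` for `k = 0, 1, 2`), in seminormal
form: `v_t ↦ a v_t + (1 / r + a) v_{s t}` with `a` the diagonal coefficient. -/
noncomputable def adjacentOp (r : K) (D : DoublePartition) (k : Fin 3) :
    Module.End K (Space K D) :=
  Finsupp.linearCombination K fun t : Tableau D =>
    diagCoeff r t.1 k • vec K D t.1 +
      (r⁻¹ + diagCoeff r t.1 k) • vec K D (t.1 ∘ Equiv.swap k.castSucc k.succ)

/-- The involution `g₀`, which acts on `v_t` by the sign of the component of the first entry. -/
noncomputable def signOp (K : Type*) [Field K] (D : DoublePartition) : Module.End K (Space K D) :=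
  Finsupp.linearCombination K fun t : Tableau D => sign K (t.1 0) • vec K D t.1

/-- The operators `g₁, g₂, g₃, g₄` (indexed by `0, 1, 2, 3`) on the Specht module `S^D`. -/
noncomputable def g (r : K) (D : DoublePartition) : Fin 4 → Module.End K (Space K D) :=
  ![signOp K D * adjacentOp r D 0 * signOp K D,
    adjacentOp r D 0, adjacentOp r D 1, adjacentOp r D 2]

/-- The linear map that exchanges the two components of each tableau of shape `(lam, lam)`; it
commutes with the action of `H(D₄)`. -/
noncomputable def exchange (K : Type*) [Field K] (lam : YoungDiagram) :
    Module.End K (Space K (lam, lam)) :=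
  Finsupp.linearCombination K fun t : Tableau (lam, lam) =>
    vec K (lam, lam) fun k => (!(t.1 k).1, (t.1 k).2)

/-- The two Specht modules `S^{(lam, lam)+}` and `S^{(lam, lam)-}` (for `ε = 1` and `ε = -1`) into
which `S^{(lam, lam)}` splits: the eigenspaces of the exchange of the components. -/
noncomputable def half (K : Type*) [Field K] (lam : YoungDiagram) (ε : ℤˣ) :
    Submodule K (Space K (lam, lam)) :=
  Module.End.eigenspace (exchange K lam) ((ε : ℤ) : K)

end

/-- The partition `(2)`: one row with two boxes. -/
def row₂ : YoungDiagram := YoungDiagram.ofRowLens [2] (by decide)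

/-- The partition `(1, 1)`: one column with two boxes. -/
def column₂ : YoungDiagram := YoungDiagram.ofRowLens [1, 1] (by decide)

end Specht

/-! ### The explicit subspaces of `V₄` -/

namespace CohenWales

variable {K : Type*} [Field K]

/-- The vector `w₁₂ - ŵ₁₂`. -/
def t₁₂ : CWSpace K := x .w12 - x .h12
/-- The vector `w₁₃ - ŵ₁₃`. -/
def t₁₃ : CWSpace K := x .w13 - x .h13
/-- The vector `w₁₄ - ŵ₁₄`. -/
def t₁₄ : CWSpace K := x .w14 - x .h14
/-- The vector `w₂₃ - ŵ₂₃`. -/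
def t₂₃ : CWSpace K := x .w23 - x .h23
/-- The vector `w₂₄ - ŵ₂₄`. -/
def t₂₄ : CWSpace K := x .w24 - x .h24
/-- The vector `w₃₄ - ŵ₃₄`. -/
def t₃₄ : CWSpace K := x .w34 - x .h34

/-- The span of the six vectors `t_{ij}`. -/
def subspaceT (K : Type*) [Field K] : Submodule K (CWSpace K) :=
  Submodule.span K {t₁₂, t₁₃, t₁₄, t₂₃, t₂₄, t₃₄}

/-- The span of `u₁, u₂, u₃`. -/
def subspaceU (r : K) : Submodule K (CWSpace K) :=
  Submodule.span K
    {m r • t₁₂ + t₁₃ + t₂₄,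
     (1 - r ^ 2) • t₁₂ + t₂₃ + t₁₄ - m r • t₂₄,
     t₁₂ + t₃₄}

/-- The span of `w₁, w₂, w₃`. -/
def subspaceW (r : K) : Submodule K (CWSpace K) :=
  Submodule.span K
    {-t₁₃ + m r • t₂₃ + t₂₄,
     -t₁₂ + m r • t₁₃ + (1 - r ^ 2) • t₂₃ + t₃₄,
     -t₂₃ + t₁₄}

end CohenWales

/-!
The three commuting operators `g₁, g₂, g₄` belong to the leaves of the diagram `D₄`, and the proof
compares their joint eigenvectors in the Specht modules and in `V₄`.

Each Specht module in question contains an explicit joint eigenvector `y` such that at least two of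
the three eigenvalues are `-r⁻¹`: the tableau combination `v₀₂ ± v₁₃ - (v₀₃ ± v₁₂)` for
`S^{(2,2)±}`, `v₀₁ ± v₂₃` for `S^{(1²,1²)±}` and `v₀₁` for `S^{(1,1),(2)}`, where the indices are
the entries of the first component. In the module, `g₃ y` is `a y` up to joint eigenvectors with
other eigenvalues, for an `a` that is read off from the seminormal form. In `V₄`, the joint
eigenspace for the given eigenvalues is at most a line
(`CohenWales.IsJointEigenvector.coordinates`), and there is a linear form with the same eigenvalues
under the transposed operators (`CohenWales.eigenform`), which kills all other joint eigenvectors.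
Evaluating this form at `g₃ y` shows that `a` is an affine function of `l⁻¹`
(`CohenWales.IsJointEigenvector.coefficient_eq`). For `S^{(2,2)±}` this yields `l = 1 / r`. In
the other two cases it is incompatible with the quadratic relation for `g₃` at `y`, which also has
to hold because it holds in the Hecke algebra.

For `l = 1 / r`, the line of joint eigenvectors lies in `𝒰` for `S^{(2,2)+}` and in `𝒲` for
`S^{(2,2)-}`. These two subspaces and the modules `S^{(2,2)±}` are spanned by *reflection triples*
(`IsReflectionTriple`): they are the deformed reflection representation of type `A₃`, pulled back
along the two foldings of `D₄` onto `A₃` that identify `g₄` with `g₂` or with `g₁`. Such a triple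
spans an irreducible module of dimension 3 which is determined by the folding, since the form of the
reflection representation is nondegenerate. Hence `𝒰` and `𝒲` realize `S^{(2,2)±}`, and any other
realization meets one of them nontrivially and so is equal to it.
-/

/-! ### Reflection triples -/

/-- The matrix of the bilinear form of the deformed reflection representation of type `A₃`. -/
def reflectionMatrix {K : Type*} [Field K] (r : K) : Matrix (Fin 3) (Fin 3) K :=
  !![-(r + r⁻¹), 1, 0; 1, -(r + r⁻¹), 1; 0, 1, -(r + r⁻¹)]

/-- The vectors `y 0, y 1, y 2` span a copy of the reflection representation of the Hecke algebra of
type `A₃`, inflated to the operators `g i` along the map `p` from their indices to the nodes of the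
diagram `A₃`: each `g i - r` maps everything to the line of `y (p i)`, as prescribed by the
reflection matrix. -/
def IsReflectionTriple {ι K V : Type*} [Field K] [AddCommGroup V] [Module K V]
    (g : ι → Module.End K V) (r : K) (p : ι → Fin 3) (y : Fin 3 → V) : Prop :=
  ∀ i j, g i (y j) = r • y j + reflectionMatrix r (p i) j • y (p i)

namespace IsReflectionTriple

variable {ι K V M : Type*} [Field K] [AddCommGroup V] [Module K V] [AddCommGroup M] [Module K M]
  {g : ι → Module.End K V} {h : ι → Module.End K M} {r : K} {p : ι → Fin 3} {y : Fin 3 → V}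
  {z : Fin 3 → M}

/-- The action on a combination of the `y j`, in coordinates. -/
theorem apply_linearCombination (hy : IsReflectionTriple g r p y) (i : ι) (c : Fin 3 → K) :
    g i (Fintype.linearCombination K y c) =
      Fintype.linearCombination K y
        (r • c + Pi.single (p i) ((reflectionMatrix r).mulVec c (p i))) := by
  rw [map_add, map_smul, Fintype.linearCombination_apply_single]
  simp only [Fintype.linearCombination_apply, map_sum, map_smul, hy i, smul_add,
    Finset.sum_add_distrib, Finset.smul_sum, Matrix.mulVec, dotProduct, Finset.sum_smul]
  congr 1
  · exact Finset.sum_congr rfl fun j _ => smul_comm _ _ _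
  · exact Finset.sum_congr rfl fun j _ => by rw [smul_smul, mul_comm]

theorem sub_smul_linearCombination (hy : IsReflectionTriple g r p y) (i : ι) (c : Fin 3 → K) :
    g i (Fintype.linearCombination K y c) - r • Fintype.linearCombination K y c =
      (reflectionMatrix r).mulVec c (p i) • y (p i) := by
  rw [hy.apply_linearCombination, map_add, map_smul, Fintype.linearCombination_apply_single,
    add_sub_cancel_left]

/-- The form is nondegenerate unless `r` is a root of unity of a small order: its determinant is
`-(r + r⁻¹) (r² + r⁻²)`. -/
theorem mulVec_eq_zero (hr : r ≠ 0) (hr2 : r ^ 2 ≠ -1) (hr4 : r ^ 4 ≠ -1) {c : Fin 3 → K}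
    (hc : (reflectionMatrix r).mulVec c = 0) : c = 0 := by
  have h0 := congrFun hc 0
  have h1 := congrFun hc 1
  have h2 := congrFun hc 2
  simp only [reflectionMatrix, Matrix.mulVec, dotProduct, Fin.sum_univ_three, Matrix.of_apply,
    Matrix.cons_val, Pi.zero_apply] at h0 h1 h2
  field_simp at h0 h1 h2
  have hr2' : r ^ 2 + 1 ≠ 0 := fun H => hr2 (by linear_combination H)
  have hr4' : r ^ 4 + 1 ≠ 0 := fun H => hr4 (by linear_combination H)
  have e1 : c 1 = 0 := by
    refine (mul_eq_zero.mp ?_).resolve_left hr4'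
    linear_combination (-r) * h0 - (r ^ 2 + 1) * h1 - r * h2
  have e0 : c 0 = 0 := by
    refine (mul_eq_zero.mp ?_).resolve_left hr2'
    linear_combination -h0 + r * e1
  have e2 : c 2 = 0 := by
    refine (mul_eq_zero.mp ?_).resolve_left hr2'
    linear_combination -h2 + r * e1
  ext j
  fin_cases j <;> assumption

/-- Adjacent vectors of a triple are obtained from each other, so they all lie in any invariant
subspace that contains one of them. -/
theorem mem_of_mem (hy : IsReflectionTriple g r p y) (hp : Function.Surjective p)
    {W : Submodule K V} (hW : IsInvariantSubspace g W) {k : Fin 3} (hk : y k ∈ W) (j : Fin 3) :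
    y j ∈ W := by
  have step : ∀ a b : Fin 3, reflectionMatrix r b a = 1 → y a ∈ W → y b ∈ W := by
    intro a b hab ha
    obtain ⟨i, rfl⟩ := hp b
    have := W.sub_mem (hW i _ ha) (W.smul_mem r ha)
    rwa [hy i a, hab, one_smul, add_sub_cancel_left] at this
  have h1 : y 1 ∈ W := by
    fin_cases k
    · exact step 0 1 (by simp [reflectionMatrix]) hk
    · exact hk
    · exact step 2 1 (by simp [reflectionMatrix]) hk
  fin_cases j
  · exact step 1 0 (by simp [reflectionMatrix]) h1
  · exact h1
  · exact step 1 2 (by simp [reflectionMatrix]) h1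

theorem ne_zero (hy : IsReflectionTriple g r p y) (hp : Function.Surjective p) (h2 : y 2 ≠ 0)
    (j : Fin 3) : y j ≠ 0 := fun h => h2 <| by
  have hinv : IsInvariantSubspace g (⊥ : Submodule K V) := by
    rintro i v hv
    rw [Submodule.mem_bot] at hv
    simp [hv]
  simpa using hy.mem_of_mem hp hinv (k := j) (by simpa using h) 2

theorem injective (hy : IsReflectionTriple g r p y) (hp : Function.Surjective p) (h2 : y 2 ≠ 0)
    (hr : r ≠ 0) (hr2 : r ^ 2 ≠ -1) (hr4 : r ^ 4 ≠ -1) :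
    Function.Injective (Fintype.linearCombination K y) := by
  rw [← LinearMap.ker_eq_bot, LinearMap.ker_eq_bot']
  intro c hc
  apply mulVec_eq_zero hr hr2 hr4
  ext k
  obtain ⟨i, rfl⟩ := hp k
  have := hy.sub_smul_linearCombination i c
  rw [hc, map_zero, smul_zero, sub_zero, eq_comm, smul_eq_zero] at this
  exact this.resolve_right (hy.ne_zero hp h2 _)

theorem finrank_range (hy : IsReflectionTriple g r p y) (hp : Function.Surjective p)
    (h2 : y 2 ≠ 0) (hr : r ≠ 0) (hr2 : r ^ 2 ≠ -1) (hr4 : r ^ 4 ≠ -1) :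
    Module.finrank K (LinearMap.range (Fintype.linearCombination K y)) = 3 := by
  rw [LinearMap.finrank_range_of_inj (hy.injective hp h2 hr hr2 hr4)]
  simp

theorem isInvariantSubspace_range (hy : IsReflectionTriple g r p y) :
    IsInvariantSubspace g (LinearMap.range (Fintype.linearCombination K y)) := by
  rintro i _ ⟨c, rfl⟩
  exact ⟨_, (hy.apply_linearCombination i c).symm⟩

theorem isIrreducibleSubspace_range (hy : IsReflectionTriple g r p y)
    (hp : Function.Surjective p) (h2 : y 2 ≠ 0) (hr : r ≠ 0) (hr2 : r ^ 2 ≠ -1)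
    (hr4 : r ^ 4 ≠ -1) :
    IsIrreducibleSubspace g (LinearMap.range (Fintype.linearCombination K y)) := by
  refine ⟨hy.isInvariantSubspace_range, ?_, fun W hW hinv => ?_⟩
  · intro h
    have := hy.finrank_range hp h2 hr hr2 hr4
    rw [h, finrank_bot] at this
    omega
  · refine or_iff_not_imp_left.mpr fun hne => le_antisymm hW ?_
    obtain ⟨v, hv, hv0⟩ := W.ne_bot_iff.mp hne
    obtain ⟨c, rfl⟩ := hW hv
    -- Some `g i - r` does not kill `v`, and it maps `v` to a multiple of `y (p i)`.
    obtain ⟨k, hk⟩ : ∃ k, (reflectionMatrix r).mulVec c k ≠ 0 := by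
      by_contra! H
      exact hv0 (by rw [mulVec_eq_zero hr hr2 hr4 (funext H), map_zero])
    obtain ⟨i, rfl⟩ := hp k
    have hmem := W.sub_mem (hinv i _ hv) (W.smul_mem r hv)
    rw [hy.sub_smul_linearCombination, W.smul_mem_iff hk] at hmem
    rw [Fintype.range_linearCombination, Submodule.span_le]
    rintro _ ⟨j, rfl⟩
    exact hy.mem_of_mem hp hinv hmem j

/-- The spans of two triples with the same parameters are isomorphic. -/
theorem areIsomorphicSubspaces_range (hy : IsReflectionTriple g r p y)
    (hz : IsReflectionTriple h r p z) (hyi : Function.Injective (Fintype.linearCombination K y))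
    (hzi : Function.Injective (Fintype.linearCombination K z)) :
    AreIsomorphicSubspaces g (LinearMap.range (Fintype.linearCombination K y))
      h (LinearMap.range (Fintype.linearCombination K z)) := by
  have key (c) : ((LinearEquiv.ofInjective _ hyi).symm.trans (LinearEquiv.ofInjective _ hzi))
      ⟨Fintype.linearCombination K y c, c, rfl⟩ =
        ⟨Fintype.linearCombination K z c, c, rfl⟩ := by
    have : (⟨Fintype.linearCombination K y c, c, rfl⟩ :
        LinearMap.range (Fintype.linearCombination K y)) = LinearEquiv.ofInjective _ hyi c := rfl
    rw [this, LinearEquiv.trans_apply, LinearEquiv.symm_apply_apply]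
    rfl
  refine ⟨hy.isInvariantSubspace_range, hz.isInvariantSubspace_range,
    (LinearEquiv.ofInjective _ hyi).symm.trans (LinearEquiv.ofInjective _ hzi), ?_⟩
  rintro i ⟨_, c, rfl⟩ ⟨_, c', rfl⟩ hw
  rw [key, key]
  simp only at hw ⊢
  rw [hy.apply_linearCombination] at hw
  rw [hyi hw, hz.apply_linearCombination]

/-- A subspace that contains a triple and is spanned by at most three vectors is the span of the
triple. -/
theorem range_eq_of_finrank_le (hy : IsReflectionTriple g r p y) (hp : Function.Surjective p)
    (h2 : y 2 ≠ 0) (hr : r ≠ 0) (hr2 : r ^ 2 ≠ -1) (hr4 : r ^ 4 ≠ -1) {W : Submodule K V}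
    [FiniteDimensional K W] (hW : ∀ j, y j ∈ W) (hfin : Module.finrank K W ≤ 3) :
    LinearMap.range (Fintype.linearCombination K y) = W := by
  apply Submodule.eq_of_le_of_finrank_le
  · rw [Fintype.range_linearCombination, Submodule.span_le]
    rintro _ ⟨j, rfl⟩
    exact hW j
  · rwa [hy.finrank_range hp h2 hr hr2 hr4]

end IsReflectionTriple

/-- Two irreducible subspaces with a common nonzero vector are equal. -/
theorem IsIrreducibleSubspace.eq_of_mem {ι K V : Type*} [Field K] [AddCommGroup V] [Module K V]
    {g : ι → Module.End K V} {W W' : Submodule K V} (hW : IsIrreducibleSubspace g W)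
    (hW' : IsIrreducibleSubspace g W') {v : V} (hv : v ∈ W) (hv' : v ∈ W') (hne : v ≠ 0) :
    W = W' := by
  have hinv : IsInvariantSubspace g (W ⊓ W') :=
    fun i u hu => ⟨hW.1 i u hu.1, hW'.1 i u hu.2⟩
  have hbot : W ⊓ W' ≠ ⊥ := (Submodule.ne_bot_iff _).mpr ⟨v, ⟨hv, hv'⟩, hne⟩
  rw [← (hW.2.2 _ inf_le_left hinv).resolve_left hbot]
  exact (hW'.2.2 _ inf_le_right hinv).resolve_left hbot
/-! ### Joint eigenvectors of `g₁, g₂, g₄` on the Cohen-Wales space -/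

namespace CohenWales

variable {K : Type*} [Field K]

theorem sum_univ (f : CWIndex → K) :
    ∑ b, f b = f .w12 + f .w13 + f .w14 + f .w23 + f .w24 + f .w34 + f .h12 + f .h13 + f .h14
      + f .h23 + f .h24 + f .h34 := by
  have : (Finset.univ : Finset CWIndex) =
    {.w12, .w13, .w14, .w23, .w24, .w34, .h12, .h13, .h14, .h23, .h24, .h34} := rfl
  rw [this]
  repeat rw [Finset.sum_insert (by decide)]
  rw [Finset.sum_singleton]
  ring

theorem g_zero_apply (l r : K) (v : CWSpace K) : g l r 0 v = fun
    | .w12 => r * v .w12 - m r * r⁻¹ * v .w13 - m r * v .w14 + m r * v .h23 + m r * r * v .h24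
        - m r ^ 2 * (r + r⁻¹) * v .h34
    | .w13 => v .h23 - m r * v .w13 - m r * r⁻¹ * v .h34
    | .w14 => v .h24 - m r * v .w14 - m r * v .h34
    | .w23 => v .h13 - m r * v .w23 - m r * v .h23 - m r * v .h34
    | .w24 => v .h14 - m r * v .w24 - m r * v .h24 - m r * r * v .h34
    | .w34 => r * v .w34
    | .h12 => l⁻¹ * v .h12 + m r * r⁻¹ * v .w13 + m r * v .w14 + m r * v .w23 + m r * r * v .w24
        + m r ^ 2 * (r + r⁻¹) * v .h34
    | .h13 => v .w23 + m r * v .w13 + m r * r⁻¹ * v .h34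
    | .h14 => v .w24 + m r * v .w14 + m r * v .h34
    | .h23 => v .w13 + m r * v .h34
    | .h24 => v .w14 + m r * r * v .h34
    | .h34 => r * v .h34 := by
  ext b
  simp only [g, Matrix.cons_val, Fintype.linearCombination_apply, Finset.sum_apply, Pi.smul_apply,
    sum_univ, image₁, x, Pi.add_apply, Pi.sub_apply, Pi.single_apply, smul_eq_mul]
  cases b <;> simp only [reduceCtorEq, if_true, if_false] <;> ring

theorem g_one_apply (l r : K) (v : CWSpace K) : g l r 1 v = fun
    | .w12 => l⁻¹ * v .w12 + m r * v .w23 + m r * r * v .w24 + m r * l⁻¹ * r⁻¹ * v .h23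
        + m r * l⁻¹ * v .h24
    | .w13 => v .w23
    | .w14 => v .w24
    | .w23 => v .w13 - m r * v .w23
    | .w24 => v .w14 - m r * v .w24
    | .w34 => r * v .w34
    | .h12 => r * v .h12
    | .h13 => v .h23
    | .h14 => v .h24
    | .h23 => v .h13 - m r * v .h23
    | .h24 => v .h14 - m r * v .h24
    | .h34 => r * v .h34 := by
  ext b
  simp only [g, Matrix.cons_val, Fintype.linearCombination_apply, Finset.sum_apply, Pi.smul_apply,
    sum_univ, image₂, x, Pi.add_apply, Pi.sub_apply, Pi.single_apply, smul_eq_mul]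
  cases b <;> simp only [reduceCtorEq, if_true, if_false] <;> ring

theorem g_two_apply (l r : K) (v : CWSpace K) : g l r 2 v = fun
    | .w12 => v .w13
    | .w13 => v .w12 - m r * v .w13
    | .w14 => r * v .w14
    | .w23 => l⁻¹ * v .w23 + m r * l⁻¹ * v .w13 + m r * v .w34 + m r * l⁻¹ * v .h13
        + m r * l⁻¹ * r⁻¹ * v .h34
    | .w24 => v .w34
    | .w34 => v .w24 - m r * v .w34
    | .h12 => v .h13
    | .h13 => v .h12 - m r * v .h13
    | .h14 => r * v .h14
    | .h23 => r * v .h23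
    | .h24 => v .h34
    | .h34 => v .h24 - m r * v .h34 := by
  ext b
  simp only [g, Matrix.cons_val, Fintype.linearCombination_apply, Finset.sum_apply, Pi.smul_apply,
    sum_univ, image₃, x, Pi.add_apply, Pi.sub_apply, Pi.single_apply, smul_eq_mul]
  cases b <;> simp only [reduceCtorEq, if_true, if_false] <;> ring

theorem g_three_apply (l r : K) (v : CWSpace K) : g l r 3 v = fun
    | .w12 => r * v .w12
    | .w13 => v .w14
    | .w14 => v .w13 - m r * v .w14
    | .w23 => v .w24
    | .w24 => v .w23 - m r * v .w24
    | .w34 => l⁻¹ * v .w34 + m r * l⁻¹ * r⁻¹ * v .w14 + m r * l⁻¹ * v .w24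
        + m r * l⁻¹ * r⁻¹ * v .h14 + m r * l⁻¹ * v .h24
    | .h12 => r * v .h12
    | .h13 => v .h14
    | .h14 => v .h13 - m r * v .h14
    | .h23 => v .h24
    | .h24 => v .h23 - m r * v .h24
    | .h34 => r * v .h34 := by
  ext b
  simp only [g, Matrix.cons_val, Fintype.linearCombination_apply, Finset.sum_apply, Pi.smul_apply,
    sum_univ, image₄, x, Pi.add_apply, Pi.sub_apply, Pi.single_apply, smul_eq_mul]
  cases b <;> simp only [reduceCtorEq, if_true, if_false] <;> ring

/-- `v` is an eigenvector (or zero) of the commuting operators `g₁, g₂, g₄`, with the eigenvalues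
`α, β, γ`. -/
structure IsJointEigenvector {V : Type*} [AddCommGroup V] [Module K V] (G : Fin 4 → Module.End K V)
    (α β γ : K) (v : V) : Prop where
  g_zero : G 0 v = α • v
  g_one : G 1 v = β • v
  g_three : G 3 v = γ • v

/-- The coordinates of a joint eigenvector, except the one at `w₁₂`, are determined by the
coordinate at `ŵ₁₃`. Those at `ŵ₃₄`, `ŵ₁₂`, `w₃₄` are multiplied by `r` under three or two of the
operators, so that they vanish if one of the eigenvalues concerned is not `r`. -/
theorem IsJointEigenvector.coordinates {l r α β γ : K} {v : CWSpace K}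
    (hv : IsJointEigenvector (g l r) α β γ v) (h34 : α ≠ r ∨ β ≠ r ∨ γ ≠ r)
    (h12 : β ≠ r ∨ γ ≠ r) (w34 : α ≠ r ∨ β ≠ r) :
    (v .h34 = 0 ∧ v .h12 = 0 ∧ v .w34 = 0) ∧
      (v .h14 = γ * v .h13 ∧ v .h23 = β * v .h13 ∧ v .h24 = β * γ * v .h13) ∧
      v .w13 = α * β * v .h13 ∧ v .w14 = α * β * γ * v .h13 ∧ v .w23 = α * β ^ 2 * v .h13 ∧
      v .w24 = α * β ^ 2 * γ * v .h13 := by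
  have ha := fun b => congrFun hv.g_zero b
  have hb := fun b => congrFun hv.g_one b
  have hc := fun b => congrFun hv.g_three b
  simp only [g_zero_apply, g_one_apply, g_three_apply, Pi.smul_apply, smul_eq_mul] at ha hb hc
  have key {s t : K} (h : s ≠ r) (e : r * t = s * t) : t = 0 :=
    (mul_eq_zero.mp (by linear_combination e : (r - s) * t = 0)).resolve_left
      (sub_ne_zero.mpr h.symm)
  have e34 : v .h34 = 0 := by
    obtain h | h | h := h34
    exacts [key h (ha .h34), key h (hb .h34), key h (hc .h34)]
  have e14 : v .h14 = γ * v .h13 := hc .h13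
  have e23 : v .h23 = β * v .h13 := hb .h13
  have e24 : v .h24 = β * γ * v .h13 := by linear_combination hb .h14 + β * e14
  have f13 : v .w13 = α * β * v .h13 := by linear_combination ha .h23 + α * e23 - m r * e34
  have f14 : v .w14 = α * β * γ * v .h13 := by
    linear_combination ha .h24 + α * e24 - m r * r * e34
  refine ⟨⟨e34, ?_, ?_⟩, ⟨e14, e23, e24⟩, f13, f14, ?_, ?_⟩
  · obtain h | h := h12
    exacts [key h (hb .h12), key h (hc .h12)]
  · obtain h | h := w34
    exacts [key h (ha .w34), key h (hb .w34)]
  · linear_combination hb .w13 + β * f13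
  · linear_combination hb .w14 + β * f14

/-- The linear form on `V₄` that is a joint eigenvector of the transposes of `g₁, g₂, g₄`, with the
eigenvalues `α, β, γ`. -/
def eigenform (α β γ : K) : CWSpace K →ₗ[K] K :=
  Fintype.linearCombination K fun
    | .w12 | .h12 | .w34 | .h34 => 0
    | .h13 => 1
    | .h14 => γ
    | .h23 => β
    | .h24 => β * γ
    | .w13 => α * β⁻¹
    | .w14 => α * β⁻¹ * γ
    | .w23 => α
    | .w24 => α * γ

theorem eigenform_apply (α β γ : K) (v : CWSpace K) :
    eigenform α β γ v = v .h13 + γ * v .h14 + β * v .h23 + β * γ * v .h24 + α * β⁻¹ * v .w13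
      + α * β⁻¹ * γ * v .w14 + α * v .w23 + α * γ * v .w24 := by
  rw [eigenform, Fintype.linearCombination_apply, sum_univ]
  simp only [smul_eq_mul]
  ring

/-- The eigenvalues of a generator of the Hecke algebra. -/
theorem quadratic_eq {r α : K} (hr : r ≠ 0) (hα : α = r ∨ α = -r⁻¹) : α ^ 2 + m r * α = 1 := by
  obtain rfl | rfl := hα <;> rw [m] <;> field_simp <;> ring

theorem eigenform_g {l r α β γ : K} (hr : r ≠ 0) (hα : α = r ∨ α = -r⁻¹) (hβ : β = r ∨ β = -r⁻¹)
    (hγ : γ = r ∨ γ = -r⁻¹) (h : α = β ∨ β = -r⁻¹ ∨ γ = -r⁻¹) (v : CWSpace K) :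
    eigenform α β γ (g l r 0 v) = α * eigenform α β γ v ∧
      eigenform α β γ (g l r 1 v) = β * eigenform α β γ v ∧
      eigenform α β γ (g l r 3 v) = γ * eigenform α β γ v := by
  have hβ0 : β ≠ 0 := by obtain rfl | rfl := hβ <;> simpa using hr
  replace hα := quadratic_eq hr hα
  replace hβ := quadratic_eq hr hβ
  replace hγ := quadratic_eq hr hγ
  replace h : (α - β) * (r * β + 1) * (r * γ + 1) = 0 := by
    obtain rfl | rfl | rfl := h <;> field_simp <;> ring
  have hβi : β⁻¹ = β + m r := by field_simp; linear_combination -hβ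
  have hbi : β * β⁻¹ = 1 := mul_inv_cancel₀ hβ0
  have hri : r * r⁻¹ = 1 := mul_inv_cancel₀ hr
  simp only [eigenform_apply, g_zero_apply, g_one_apply, g_three_apply]
  refine ⟨?_, ?_, ?_⟩
  · linear_combination (v .w13 + γ * v .w14) * (-β⁻¹ * hα - hβi) - (v .w23 + γ * v .w24) * hα
      + (v .h23 + γ * v .h24) * α * hβi
      + m r * v .h34 * (-(r⁻¹ + γ) * hbi - r⁻¹ * β⁻¹ * h
        - (β - α) * ((β⁻¹ * β + β⁻¹ * γ + r * γ * β⁻¹ * β) * hri + (1 + r * γ) * hbi))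
  · linear_combination -(v .h23 + γ * v .h24) * hβ - (v .w13 + γ * v .w14) * α * hbi
      + (v .w23 + γ * v .w24) * α * hβi
  · linear_combination -(v .h14 + β * v .h24 + α * β⁻¹ * v .w14 + α * v .w24) * hγ

/-- An eigenvector of the transpose of `G` kills the eigenvectors of `G` for other eigenvalues. -/
theorem eq_zero_of_eigenvalue_ne {α β : K} {G : Module.End K (CWSpace K)}
    {f : CWSpace K →ₗ[K] K} (hf : ∀ v, f (G v) = α * f v) {v : CWSpace K} (hv : G v = β • v)
    (hne : α ≠ β) : f v = 0 := by
  have := hf v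
  rw [hv, map_smul, smul_eq_mul] at this
  exact (mul_eq_zero.mp (by linear_combination this : (β - α) * f v = 0)).resolve_left
    (sub_ne_zero.mpr hne.symm)

theorem neg_inv_ne {r : K} (hr : r ≠ 0) (hr2 : r ^ 2 ≠ -1) : -r⁻¹ ≠ r := by
  intro H
  field_simp at H
  exact hr2 (by linear_combination -H)

/-- The matrix coefficient of `g₃` at a joint eigenvector `v` with eigenvalue `-r⁻¹` for at least
two of `g₁, g₂, g₄`: if `g₃ v` is `a v` up to vectors killed by the eigenform, then `a` is a certain
affine function of `l⁻¹`. -/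
theorem IsJointEigenvector.coefficient_eq {l r α β γ a : K} (hr : r ≠ 0) (hr2 : r ^ 2 ≠ -1)
    {v : CWSpace K} (hv : IsJointEigenvector (g l r) α β γ v)
    (hα : α = r ∨ α = -r⁻¹) (hβ : β = r ∨ β = -r⁻¹) (hγ : γ = r ∨ γ = -r⁻¹)
    (h : β = -r⁻¹ ∧ γ = -r⁻¹ ∨ α = -r⁻¹ ∧ γ = -r⁻¹ ∨ α = -r⁻¹ ∧ β = -r⁻¹)
    (ha : eigenform α β γ (g l r 2 v) = a * eigenform α β γ v) :
    α * β⁻¹ * v .w12 + (l⁻¹ + (r * γ ^ 2 - m r) * (1 + α ^ 2) + r * β ^ 2) * v .h13 =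
        a * ((1 + α ^ 2) * (1 + β ^ 2) * (1 + γ ^ 2)) * v .h13 := by
  have hne := neg_inv_ne hr hr2
  have hβ0 : β ≠ 0 := by obtain rfl | rfl := hβ <;> simpa using hr
  obtain ⟨⟨e34, e12, f34⟩, ⟨e14, e23, e24⟩, f13, f14, f23, f24⟩ := hv.coordinates
    (by obtain ⟨h, h'⟩ | ⟨h, h'⟩ | ⟨h, h'⟩ := h <;> simp [h, h', hne])
    (by obtain ⟨h, h'⟩ | ⟨h, h'⟩ | ⟨h, h'⟩ := h <;> simp [h, h', hne])
    (by obtain ⟨h, h'⟩ | ⟨h, h'⟩ | ⟨h, h'⟩ := h <;> simp [h, h', hne])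
  replace hα := quadratic_eq hr hα
  replace hβ := quadratic_eq hr hβ
  have hβi : β⁻¹ = β + m r := by field_simp; linear_combination -hβ
  have hbi : β * β⁻¹ = 1 := mul_inv_cancel₀ hβ0
  simp only [eigenform_apply, g_two_apply, e34, e12, f34, e14, e23, e24, f13, f14, f23, f24] at ha
  linear_combination ha - v .h13 * (α ^ 2 * (r * γ ^ 2 - m r) * hbi + l⁻¹ * (α ^ 2 * hβ + hα))
    + a * v .h13 * α ^ 2 * (1 + γ ^ 2) * hbi

/-- Vectors killed by the quadratic polynomial of `g₃`, that is, by `e₃`. -/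
theorem quadratic_two_apply {l r : K} {v : CWSpace K}
    (h : g l r 2 (g l r 2 v) + m r • g l r 2 v = v) :
    m r * l⁻¹ * (v .w12 - m r * v .w13) + (l⁻¹ + m r) * (l⁻¹ * v .w23 + m r * l⁻¹ * v .w13
        + m r * v .w34 + m r * l⁻¹ * v .h13 + m r * l⁻¹ * r⁻¹ * v .h34)
      + m r * (v .w24 - m r * v .w34) + m r * l⁻¹ * (v .h12 - m r * v .h13)
      + m r * l⁻¹ * r⁻¹ * (v .h24 - m r * v .h34) = v .w23 := by
  have := congrFun h .w23
  simp only [g_two_apply, Pi.add_apply, Pi.smul_apply, smul_eq_mul] at this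
  linear_combination this

theorem IsJointEigenvector.w12_eq_zero {l r α β γ : K} {v : CWSpace K}
    (hv : IsJointEigenvector (g l r) α β γ v) (hγ : γ ≠ r) : v .w12 = 0 := by
  have := congrFun hv.g_three .w12
  simp only [g_three_apply, Pi.smul_apply, smul_eq_mul] at this
  exact (mul_eq_zero.mp (by linear_combination this : (r - γ) * v .w12 = 0)).resolve_left
    (sub_ne_zero.mpr hγ.symm)

theorem IsJointEigenvector.eq_zero {l r α β γ : K} {v : CWSpace K}
    (hv : IsJointEigenvector (g l r) α β γ v) (h34 : α ≠ r ∨ β ≠ r ∨ γ ≠ r)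
    (h12 : β ≠ r ∨ γ ≠ r) (w34 : α ≠ r ∨ β ≠ r) (h13 : v .h13 = 0) (w12 : v .w12 = 0) :
    v = 0 := by
  obtain ⟨⟨e34, e12, f34⟩, ⟨e14, e23, e24⟩, f13, f14, f23, f24⟩ := hv.coordinates h34 h12 w34
  rw [h13, mul_zero] at e14 e23 e24 f13 f14 f23 f24
  ext b
  cases b <;> assumption

/-- The joint eigenvectors that generate `S^{(2,2)±}` exist only if `l = 1 / r`. -/
theorem IsJointEigenvector.eq_one_div {l r α β : K} (hl : l ≠ 0) (hr : r ≠ 0) (hr2 : r ^ 2 ≠ -1)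
    {v : CWSpace K} (hv : IsJointEigenvector (g l r) α β (-r⁻¹) v)
    (h : α = r ∧ β = -r⁻¹ ∨ α = -r⁻¹ ∧ β = r) (hne : v ≠ 0)
    (ha : eigenform α β (-r⁻¹) (g l r 2 v) =
      r ^ 3 / (r ^ 2 + 1) * eigenform α β (-r⁻¹) v) :
    l = 1 / r := by
  have hn := neg_inv_ne hr hr2
  have hr2' : r ^ 2 + 1 ≠ 0 := fun H => hr2 (by linear_combination H)
  have hw : v .w12 = 0 := hv.w12_eq_zero hn
  have hc : v .h13 ≠ 0 := fun hc => hne <| hv.eq_zero (by simp [hn]) (by simp [hn])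
    (by obtain ⟨h, h'⟩ | ⟨h, h'⟩ := h <;> simp [h, h', hn]) hc hw
  have := hv.coefficient_eq hr hr2 (by tauto) (by tauto) (by tauto) (by tauto) ha
  rw [hw, mul_zero, zero_add] at this
  replace this := mul_right_cancel₀ hc this
  rw [eq_div_iff hr]
  obtain ⟨rfl, rfl⟩ | ⟨rfl, rfl⟩ := h <;> rw [m] at this <;> field_simp at this
  · exact mul_left_cancel₀ hr (by linear_combination -this)
  · exact mul_left_cancel₀ (pow_ne_zero 3 hr) (by linear_combination -this)

/-- The joint eigenvectors that generate `S^{(1²,1²)±}` do not exist: the quadratic relation for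
`g₃` requires `l² = r⁶`, and the matrix coefficient requires `l (r⁴ + r² + 1) = -r⁵`. -/
theorem IsJointEigenvector.eq_zero_of_neg_neg_neg {l r : K} (hl : l ≠ 0) (hr : r ≠ 0)
    (hr2 : r ^ 2 ≠ -1) (hr4 : r ^ 4 ≠ -1) {v : CWSpace K}
    (hv : IsJointEigenvector (g l r) (-r⁻¹) (-r⁻¹) (-r⁻¹) v)
    (hq : g l r 2 (g l r 2 v) + m r • g l r 2 v = v)
    (ha : eigenform (-r⁻¹) (-r⁻¹) (-r⁻¹) (g l r 2 v) =
      r * (r ^ 2 - 1) / (r ^ 2 + 1) * eigenform (-r⁻¹) (-r⁻¹) (-r⁻¹) v) :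
    v = 0 := by
  have hn := neg_inv_ne hr hr2
  have hr2' : r ^ 2 + 1 ≠ 0 := fun H => hr2 (by linear_combination H)
  have hr4' : r ^ 4 + 1 ≠ 0 := fun H => hr4 (by linear_combination H)
  have hw : v .w12 = 0 := hv.w12_eq_zero hn
  by_contra hne
  have hc : v .h13 ≠ 0 := fun hc => hne <| hv.eq_zero (by simp [hn]) (by simp [hn])
    (by simp [hn]) hc hw
  have := hv.coefficient_eq hr hr2 (by tauto) (by tauto) (by tauto) (by tauto) ha
  rw [hw, mul_zero, zero_add] at this
  replace this := mul_right_cancel₀ hc this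
  replace hq := quadratic_two_apply hq
  obtain ⟨⟨e34, e12, f34⟩, ⟨e14, e23, e24⟩, f13, f14, f23, f24⟩ := hv.coordinates (by simp [hn])
    (by simp [hn]) (by simp [hn])
  simp only [hw, e34, e12, f34, e24, f13, f23, f24] at hq
  rw [m] at this hq
  have hq' : l ^ 2 = r ^ 6 := by
    refine mul_right_cancel₀ hc ?_
    field_simp at hq
    linear_combination hq
  have hl' : l * (r ^ 4 + r ^ 2 + 1) = -r ^ 5 := by
    field_simp at this
    linear_combination this
  -- Eliminating `l` leaves a product of factors that do not vanish.
  have : r ^ 6 * ((r ^ 4 + 1) * (r ^ 2 + 1) ^ 2) = 0 := by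
    linear_combination -(r ^ 4 + r ^ 2 + 1) ^ 2 * hq' + (l * (r ^ 4 + r ^ 2 + 1) - r ^ 5) * hl'
  simp [hr, hr2', hr4'] at this

/-- The joint eigenvectors that generate `S^{(1,1),(2)}` do not exist: the quadratic relation for
`g₃` requires `l = r⁻¹` or `l = -r³`, and the matrix coefficient requires `l (1 + 2 r²) = -r³`. -/
theorem IsJointEigenvector.eq_zero_of_neg_neg_pos [CharZero K] {l r : K} (hl : l ≠ 0) (hr : r ≠ 0)
    (hr2 : r ^ 2 ≠ -1) {v : CWSpace K}
    (hv : IsJointEigenvector (g l r) (-r⁻¹) (-r⁻¹) r v)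
    (hq : g l r 2 (g l r 2 v) + m r • g l r 2 v = v)
    (ha : eigenform (-r⁻¹) (-r⁻¹) r (g l r 2 v) =
      r * (r ^ 2 - 1) / (r ^ 2 + 1) * eigenform (-r⁻¹) (-r⁻¹) r v) :
    v = 0 := by
  have hn := neg_inv_ne hr hr2
  have hr2' : r ^ 2 + 1 ≠ 0 := fun H => hr2 (by linear_combination H)
  obtain ⟨⟨e34, e12, f34⟩, ⟨e14, e23, e24⟩, f13, f14, f23, f24⟩ := hv.coordinates (by simp [hn])
    (by simp [hn]) (by simp [hn])
  have hw : v .w12 = m r * (1 + (r ^ 2)⁻¹) * v .h13 := by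
    have := congrFun hv.g_zero .w12
    simp only [g_zero_apply, Pi.smul_apply, smul_eq_mul, e34, e23, e24, f13, f14] at this
    field_simp at this ⊢
    apply mul_left_cancel₀ hr2'
    linear_combination this
  by_contra hne
  have hc : v .h13 ≠ 0 := fun hc => hne <| hv.eq_zero (by simp [hn]) (by simp [hn])
    (by simp [hn]) hc (by rw [hw, hc, mul_zero])
  have := hv.coefficient_eq hr hr2 (by tauto) (by tauto) (by tauto) (by tauto) ha
  replace hq := quadratic_two_apply hq
  simp only [hw, e34, e12, f34, e24, f13, f23, f24] at this hq
  rw [m] at this hq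
  have hq' : r * l ^ 2 + (r ^ 4 - 1) * l = r ^ 3 := by
    refine mul_left_cancel₀ (pow_ne_zero 2 hr) (mul_right_cancel₀ hc ?_)
    field_simp at hq
    linear_combination hq
  have hl' : l * (1 + 2 * r ^ 2) = -r ^ 3 := by
    refine mul_right_cancel₀ hc ?_
    field_simp at this
    linear_combination v .h13 * this
  -- Eliminating `l` leaves a product of factors that do not vanish.
  have hl'' : l = -r * (r ^ 2 + 2) := by
    refine mul_left_cancel₀ (mul_ne_zero hr hl) ?_
    linear_combination hq' + hl'
  have : 2 * r * (r ^ 2 + 1) ^ 2 = 0 := by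
    rw [hl''] at hl'
    linear_combination -hl'
  simp [hr, hr2'] at this

end CohenWales
/-! ### The subspaces `𝒰` and `𝒲` -/

namespace CohenWales

variable {K : Type*} [Field K]

/-- The folding of the diagram `D₄` onto `A₃` (on indices) that maps the branch node to the middle
node and identifies the node of `g₄` with that of `g₂` (for `ε = 1`) or `g₁` (for `ε = -1`). -/
def fold (ε : ℤˣ) : Fin 4 → Fin 3 := if ε = 1 then ![0, 2, 1, 2] else ![2, 0, 1, 2]

theorem fold_surjective (ε : ℤˣ) : Function.Surjective (fold ε) := by
  obtain rfl | rfl := Int.units_eq_one_or ε <;> decide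

/-- A reflection triple that spans `𝒰` if `l = 1 / r`. -/
def tripleU (r : K) : Fin 3 → CWSpace K :=
  ![-(r⁻¹ ^ 2 • (m r • t₁₂ + t₁₃ + t₂₄)) - r⁻¹ • ((1 - r ^ 2) • t₁₂ + t₂₃ + t₁₄ - m r • t₂₄),
    r • (m r • t₁₂ + t₁₃ + t₂₄) - (t₁₂ + t₃₄),
    -(r ^ 2 • (m r • t₁₂ + t₁₃ + t₂₄)) + r • ((1 - r ^ 2) • t₁₂ + t₂₃ + t₁₄ - m r • t₂₄)]

/-- A reflection triple that spans `𝒲` if `l = 1 / r`. -/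
def tripleW (r : K) : Fin 3 → CWSpace K :=
  ![-(-t₁₃ + m r • t₂₃ + t₂₄) + r • (-t₂₃ + t₁₄),
    r • (-t₁₃ + m r • t₂₃ + t₂₄) - (-t₁₂ + m r • t₁₃ + (1 - r ^ 2) • t₂₃ + t₃₄),
    -(-t₁₃ + m r • t₂₃ + t₂₄) - r⁻¹ • (-t₂₃ + t₁₄)]

/-- Coordinates of a combination of the `t_{ij}`. -/
theorem combination_t (a b c d e f : K) :
    (a • t₁₂ + b • t₁₃ + c • t₁₄ + d • t₂₃ + e • t₂₄ + f • t₃₄ : CWSpace K) = fun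
    | .w12 => a | .w13 => b | .w14 => c | .w23 => d | .w24 => e | .w34 => f
    | .h12 => -a | .h13 => -b | .h14 => -c | .h23 => -d | .h24 => -e | .h34 => -f := by
  ext b
  cases b <;> simp [t₁₂, t₁₃, t₁₄, t₂₃, t₂₄, t₃₄, x]

theorem tripleU_zero {r : K} (hr : r ≠ 0) : tripleU r 0 = (r - (r ^ 3)⁻¹) • t₁₂ +
    (-(r ^ 2)⁻¹) • t₁₃ + (-r⁻¹) • t₁₄ + (-r⁻¹) • t₂₃ + (-1 : K) • t₂₄ + (0 : K) • t₃₄ := by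
  simp only [tripleU, Matrix.cons_val, m]
  match_scalars <;> field_simp <;> ring

theorem tripleU_one {r : K} (hr : r ≠ 0) : tripleU r 1 = (-r ^ 2) • t₁₂ +
    r • t₁₃ + (0 : K) • t₁₄ + (0 : K) • t₂₃ + r • t₂₄ + (-1 : K) • t₃₄ := by
  simp only [tripleU, Matrix.cons_val, m]
  match_scalars <;> field_simp
  ring

theorem tripleU_two {r : K} (hr : r ≠ 0) : tripleU r 2 = (0 : K) • t₁₂ +
    (-r ^ 2) • t₁₃ + r • t₁₄ + r • t₂₃ + (-1 : K) • t₂₄ + (0 : K) • t₃₄ := by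
  simp only [tripleU, Matrix.cons_val, m]
  match_scalars <;> field_simp <;> ring

theorem tripleW_zero {r : K} (hr : r ≠ 0) : tripleW r 0 = (0 : K) • t₁₂ +
    (1 : K) • t₁₃ + r • t₁₄ + (-r⁻¹) • t₂₃ + (-1 : K) • t₂₄ + (0 : K) • t₃₄ := by
  simp only [tripleW, Matrix.cons_val, m]
  match_scalars <;> field_simp
  ring

theorem tripleW_one {r : K} (hr : r ≠ 0) : tripleW r 1 = (1 : K) • t₁₂ +
    (-r⁻¹) • t₁₃ + (0 : K) • t₁₄ + (0 : K) • t₂₃ + r • t₂₄ + (-1 : K) • t₃₄ := by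
  simp only [tripleW, Matrix.cons_val, m]
  match_scalars <;> field_simp <;> ring

theorem tripleW_two {r : K} (hr : r ≠ 0) : tripleW r 2 = (0 : K) • t₁₂ +
    (1 : K) • t₁₃ + (-r⁻¹) • t₁₄ + r • t₂₃ + (-1 : K) • t₂₄ + (0 : K) • t₃₄ := by
  simp only [tripleW, Matrix.cons_val, m]
  match_scalars <;> field_simp
  ring

theorem isReflectionTriple_tripleU {r : K} (hr : r ≠ 0) :
    IsReflectionTriple (g r⁻¹ r) r (fold 1) (tripleU r) := by
  have h0 := tripleU_zero hr
  have h1 := tripleU_one hr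
  have h2 := tripleU_two hr
  rw [combination_t] at h0 h1 h2
  intro i j
  fin_cases i <;> fin_cases j <;>
    simp only [fold, if_true, Fin.zero_eta, Fin.mk_one, Fin.reduceFinMk, Matrix.cons_val,
      reflectionMatrix, Matrix.of_apply, h0, h1, h2, g_zero_apply, g_one_apply, g_two_apply,
      g_three_apply] <;> ext b <;> cases b <;>
    simp only [Pi.add_apply, Pi.smul_apply, smul_eq_mul, m] <;> field_simp <;> ring

theorem isReflectionTriple_tripleW {r : K} (hr : r ≠ 0) :
    IsReflectionTriple (g r⁻¹ r) r (fold (-1)) (tripleW r) := by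
  have h0 := tripleW_zero hr
  have h1 := tripleW_one hr
  have h2 := tripleW_two hr
  rw [combination_t] at h0 h1 h2
  intro i j
  fin_cases i <;> fin_cases j <;>
    simp only [fold, show ¬((-1 : ℤˣ) = 1) by decide, if_false, Fin.zero_eta, Fin.mk_one,
      Fin.reduceFinMk, Matrix.cons_val,
      reflectionMatrix, Matrix.of_apply, h0, h1, h2, g_zero_apply, g_one_apply, g_two_apply,
      g_three_apply] <;> ext b <;> cases b <;>
    simp only [Pi.add_apply, Pi.smul_apply, smul_eq_mul, m] <;> field_simp <;> ring

theorem finrank_span_triple_le {V : Type*} [AddCommGroup V] [Module K V] (a b c : V) :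
    Module.finrank K (Submodule.span K {a, b, c}) ≤ 3 := by
  have : ({a, b, c} : Set V) = Set.range ![a, b, c] := by
    simp only [Matrix.range_cons, Matrix.range_empty, Set.union_empty, Set.singleton_union]
  rw [this]
  exact (finrank_range_le_card ![a, b, c]).trans (by simp)

theorem tripleU_two_ne_zero {r : K} (hr : r ≠ 0) : tripleU r 2 ≠ 0 := fun h => by
  have := congrFun h .w24
  rw [tripleU_two hr, combination_t] at this
  simp at this

theorem tripleW_two_ne_zero {r : K} (hr : r ≠ 0) : tripleW r 2 ≠ 0 := fun h => by
  have := congrFun h .w24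
  rw [tripleW_two hr, combination_t] at this
  simp at this

theorem range_tripleU {r : K} (hr : r ≠ 0) (hr2 : r ^ 2 ≠ -1) (hr4 : r ^ 4 ≠ -1) :
    LinearMap.range (Fintype.linearCombination K (tripleU r)) = subspaceU r := by
  refine (isReflectionTriple_tripleU hr).range_eq_of_finrank_le (fold_surjective 1)
    (tripleU_two_ne_zero hr) hr hr2 hr4 (fun j => ?_) (finrank_span_triple_le _ _ _)
  have h0 : _ ∈ subspaceU r := Submodule.subset_span (Or.inl rfl)
  have h1 : _ ∈ subspaceU r := Submodule.subset_span (Or.inr (Or.inl rfl))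
  have h2 : _ ∈ subspaceU r := Submodule.subset_span (Or.inr (Or.inr rfl))
  fin_cases j
  · exact sub_mem (neg_mem (Submodule.smul_mem _ _ h0)) (Submodule.smul_mem _ _ h1)
  · exact sub_mem (Submodule.smul_mem _ _ h0) h2
  · exact add_mem (neg_mem (Submodule.smul_mem _ _ h0)) (Submodule.smul_mem _ _ h1)

theorem range_tripleW {r : K} (hr : r ≠ 0) (hr2 : r ^ 2 ≠ -1) (hr4 : r ^ 4 ≠ -1) :
    LinearMap.range (Fintype.linearCombination K (tripleW r)) = subspaceW r := by
  refine (isReflectionTriple_tripleW hr).range_eq_of_finrank_le (fold_surjective (-1))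
    (tripleW_two_ne_zero hr) hr hr2 hr4 (fun j => ?_) (finrank_span_triple_le _ _ _)
  have h0 : _ ∈ subspaceW r := Submodule.subset_span (Or.inl rfl)
  have h1 : _ ∈ subspaceW r := Submodule.subset_span (Or.inr (Or.inl rfl))
  have h2 : _ ∈ subspaceW r := Submodule.subset_span (Or.inr (Or.inr rfl))
  fin_cases j
  · exact add_mem (neg_mem h0) (Submodule.smul_mem _ _ h2)
  · exact sub_mem (Submodule.smul_mem _ _ h0) h1
  · exact sub_mem (neg_mem h0) (Submodule.smul_mem _ _ h2)

/-- The subspace `𝒰` for `ε = 1`, and `𝒲` for `ε = -1`. -/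
def subspaceUW (r : K) (ε : ℤˣ) : Submodule K (CWSpace K) :=
  if ε = 1 then subspaceU r else subspaceW r

theorem subspaceUW_one (r : K) : subspaceUW r 1 = subspaceU r := if_pos rfl

theorem subspaceUW_neg_one (r : K) : subspaceUW r (-1) = subspaceW r := if_neg (by decide)

/-- For `l = 1 / r`, the subspaces `𝒰` and `𝒲` are spanned by reflection triples. -/
theorem exists_isReflectionTriple {r : K} (hr : r ≠ 0) (hr2 : r ^ 2 ≠ -1) (hr4 : r ^ 4 ≠ -1)
    (ε : ℤˣ) :
    ∃ y, IsReflectionTriple (g r⁻¹ r) r (fold ε) y ∧ y 2 ≠ 0 ∧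
      LinearMap.range (Fintype.linearCombination K y) = subspaceUW r ε := by
  obtain rfl | rfl := Int.units_eq_one_or ε
  · exact ⟨_, isReflectionTriple_tripleU hr, tripleU_two_ne_zero hr,
      (range_tripleU hr hr2 hr4).trans (subspaceUW_one r).symm⟩
  · exact ⟨_, isReflectionTriple_tripleW hr, tripleW_two_ne_zero hr,
      (range_tripleW hr hr2 hr4).trans (subspaceUW_neg_one r).symm⟩

/-- The joint eigenvectors that occur in `S^{(2,2)±}` lie in `𝒰` or `𝒲`. -/
theorem IsJointEigenvector.mem_subspaceUW {l r : K} (hr : r ≠ 0) (hr2 : r ^ 2 ≠ -1)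
    (hr4 : r ^ 4 ≠ -1) {v : CWSpace K} {ε : ℤˣ}
    (hv : IsJointEigenvector (g l r) (if ε = 1 then r else -r⁻¹) (if ε = 1 then -r⁻¹ else r)
      (-r⁻¹) v) :
    v ∈ subspaceUW r ε := by
  have hn := neg_inv_ne hr hr2
  have hw := hv.w12_eq_zero hn
  obtain rfl | rfl := Int.units_eq_one_or ε
  · simp only [if_true] at hv
    obtain ⟨⟨e34, e12, f34⟩, ⟨e14, e23, e24⟩, f13, f14, f23, f24⟩ := hv.coordinates (by simp [hn])
      (by simp [hn]) (by simp [hn])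
    rw [subspaceUW_one, ← range_tripleU hr hr2 hr4,
      Fintype.range_linearCombination]
    have : v = ((r ^ 2)⁻¹ * v .h13) • tripleU r 2 := by
      rw [tripleU_two hr, combination_t]
      ext b
      cases b <;> simp only [Pi.smul_apply, smul_eq_mul, hw, e34, e12, f34, e14, e23, e24, f13,
        f14, f23, f24] <;> field_simp <;> ring
    rw [this]
    exact Submodule.smul_mem _ _ (Submodule.subset_span ⟨2, rfl⟩)
  · simp only [show ¬((-1 : ℤˣ) = 1) by decide, if_false] at hv
    obtain ⟨⟨e34, e12, f34⟩, ⟨e14, e23, e24⟩, f13, f14, f23, f24⟩ := hv.coordinates (by simp [hn])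
      (by simp [hn]) (by simp [hn])
    rw [subspaceUW_neg_one, ← range_tripleW hr hr2 hr4,
      Fintype.range_linearCombination]
    have : v = (-v .h13) • tripleW r 2 := by
      rw [tripleW_two hr, combination_t]
      ext b
      cases b <;> simp only [Pi.smul_apply, smul_eq_mul, hw, e34, e12, f34, e14, e23, e24, f13,
        f14, f23, f24] <;> field_simp <;> ring
    rw [this]
    exact Submodule.smul_mem _ _ (Submodule.subset_span ⟨2, rfl⟩)

theorem isIrreducibleSubspace_subspaceUW {r : K} (hr : r ≠ 0) (hr2 : r ^ 2 ≠ -1)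
    (hr4 : r ^ 4 ≠ -1) (ε : ℤˣ) : IsIrreducibleSubspace (g r⁻¹ r) (subspaceUW r ε) := by
  obtain ⟨y, hy, h2, hrange⟩ := exists_isReflectionTriple hr hr2 hr4 ε
  rw [← hrange]
  exact hy.isIrreducibleSubspace_range (fold_surjective ε) h2 hr hr2 hr4

theorem finrank_subspaceUW {r : K} (hr : r ≠ 0) (hr2 : r ^ 2 ≠ -1)
    (hr4 : r ^ 4 ≠ -1) (ε : ℤˣ) : Module.finrank K (subspaceUW r ε) = 3 := by
  obtain ⟨y, hy, h2, hrange⟩ := exists_isReflectionTriple hr hr2 hr4 ε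
  rw [← hrange]
  exact hy.finrank_range (fold_surjective ε) h2 hr hr2 hr4

theorem mem_subspaceT (a b c d e f : K) :
    a • t₁₂ + b • t₁₃ + c • t₁₄ + d • t₂₃ + e • t₂₄ + f • t₃₄ ∈ subspaceT K := by
  have h (t) (ht : t ∈ ({t₁₂, t₁₃, t₁₄, t₂₃, t₂₄, t₃₄} : Set (CWSpace K))) (a : K) :
      a • t ∈ subspaceT K := Submodule.smul_mem _ _ (Submodule.subset_span ht)
  refine add_mem (add_mem (add_mem (add_mem (add_mem ?_ ?_) ?_) ?_) ?_) ?_ <;>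
    exact h _ (by simp) _

theorem finrank_subspaceT_le : Module.finrank K (subspaceT K) ≤ 6 := by
  have : ({t₁₂, t₁₃, t₁₄, t₂₃, t₂₄, t₃₄} : Set (CWSpace K)) =
      Set.range ![t₁₂, t₁₃, t₁₄, t₂₃, t₂₄, t₃₄] := by
    simp only [Matrix.range_cons, Matrix.range_empty, Set.union_empty, Set.singleton_union]
  rw [subspaceT, this]
  exact (finrank_range_le_card _).trans (by simp)

/-- `𝒰` and `𝒲` are different, since `g₂ = g₄` on `𝒰` and `g₁ = g₄` on `𝒲`. -/
theorem subspaceU_ne_subspaceW {r : K} (hr : r ≠ 0) (hr2 : r ^ 2 ≠ -1) (hr4 : r ^ 4 ≠ -1) :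
    subspaceU r ≠ subspaceW r := fun h => by
  rw [← range_tripleU hr hr2 hr4, ← range_tripleW hr hr2 hr4] at h
  obtain ⟨c, hc⟩ : tripleW r 2 ∈ LinearMap.range (Fintype.linearCombination K (tripleU r)) := by
    rw [h, Fintype.range_linearCombination]
    exact Submodule.subset_span ⟨2, rfl⟩
  have h1 := (isReflectionTriple_tripleU hr).apply_linearCombination 1 c
  have h3 := (isReflectionTriple_tripleU hr).apply_linearCombination 3 c
  have h13 : fold 1 1 = fold 1 3 := rfl
  rw [h13, ← h3, hc, isReflectionTriple_tripleW hr 1 2, isReflectionTriple_tripleW hr 3 2] at h1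
  have : (-r⁻¹ + -r) • tripleW r 2 = 0 := by
    simpa [fold, reflectionMatrix, show ¬((-1 : ℤˣ) = 1) by decide] using h1
  rw [smul_eq_zero] at this
  refine (this.resolve_right (tripleW_two_ne_zero hr)) |> fun H => hr2 ?_
  field_simp at H
  linear_combination -H

theorem subspaceU_inf_subspaceW {r : K} (hr : r ≠ 0) (hr2 : r ^ 2 ≠ -1) (hr4 : r ^ 4 ≠ -1) :
    subspaceU r ⊓ subspaceW r = ⊥ := by
  by_contra h
  obtain ⟨v, hv, hv0⟩ := (Submodule.ne_bot_iff _).mp h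
  have hU : IsIrreducibleSubspace (g r⁻¹ r) (subspaceU r) :=
    subspaceUW_one r ▸ isIrreducibleSubspace_subspaceUW hr hr2 hr4 1
  have hW : IsIrreducibleSubspace (g r⁻¹ r) (subspaceW r) :=
    subspaceUW_neg_one r ▸ isIrreducibleSubspace_subspaceUW hr hr2 hr4 (-1)
  exact subspaceU_ne_subspaceW hr hr2 hr4 (hU.eq_of_mem hW hv.1 hv.2 hv0)

theorem subspaceU_sup_subspaceW {r : K} (hr : r ≠ 0) (hr2 : r ^ 2 ≠ -1) (hr4 : r ^ 4 ≠ -1) :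
    subspaceU r ⊔ subspaceW r = subspaceT K ∧ Module.finrank K (subspaceT K) = 6 := by
  have hU := finrank_subspaceUW hr hr2 hr4 1
  have hW := finrank_subspaceUW hr hr2 hr4 (-1)
  rw [subspaceUW_one] at hU
  rw [subspaceUW_neg_one] at hW
  have hsup := Submodule.finrank_sup_add_finrank_inf_eq (subspaceU r) (subspaceW r)
  rw [subspaceU_inf_subspaceW hr hr2 hr4, finrank_bot, hU, hW] at hsup
  have hle : subspaceU r ⊔ subspaceW r ≤ subspaceT K := by
    rw [← range_tripleU hr hr2 hr4, ← range_tripleW hr hr2 hr4, Fintype.range_linearCombination,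
      Fintype.range_linearCombination, sup_le_iff, Submodule.span_le, Submodule.span_le]
    constructor
    · rintro _ ⟨j, rfl⟩
      fin_cases j
      · exact tripleU_zero hr ▸ mem_subspaceT _ _ _ _ _ _
      · exact tripleU_one hr ▸ mem_subspaceT _ _ _ _ _ _
      · exact tripleU_two hr ▸ mem_subspaceT _ _ _ _ _ _
    · rintro _ ⟨j, rfl⟩
      fin_cases j
      · exact tripleW_zero hr ▸ mem_subspaceT _ _ _ _ _ _
      · exact tripleW_one hr ▸ mem_subspaceT _ _ _ _ _ _
      · exact tripleW_two hr ▸ mem_subspaceT _ _ _ _ _ _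
  have heq := Submodule.eq_of_le_of_finrank_le hle (by have := finrank_subspaceT_le (K := K); omega)
  refine ⟨heq, ?_⟩
  rw [← heq]
  omega

end CohenWales
/-! ### Standard double tableaux for two diagrams with two boxes in a line -/

namespace Specht

/-- The partition `(2)` for `false`, and `(1, 1)` for `true`. -/
def shape : Bool → YoungDiagram
  | false => row₂
  | true => column₂

/-- The double partition whose components are given by the two values of `d`. -/
abbrev shapes (d : Bool → Bool) : DoublePartition := (shape (d false), shape (d true))

/-- The first (`p.2 = false`) or second (`p.2 = true`) box of the component `p.1`. -/
def box (d : Bool → Bool) (p : Bool × Bool) : Box :=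
  (p.1, if d p.1 then (p.2.toNat, 0) else (0, p.2.toNat))

theorem mem_shape (b : Bool) (c : ℕ × ℕ) :
    c ∈ shape b ↔ ∃ j : Bool, (if b then (j.toNat, 0) else (0, j.toNat)) = c := by
  rcases c with ⟨i, j⟩
  cases b
  · rw [shape, row₂, YoungDiagram.mem_ofRowLens]
    simp [Bool.exists_bool]
    omega
  · rw [shape, column₂, YoungDiagram.mem_ofRowLens]
    simp [Bool.exists_bool]
    constructor
    · rintro ⟨h, h'⟩
      interval_cases i <;> simp_all
    · rintro ⟨rfl | rfl, h⟩ <;> simp [← h]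

theorem inDiagram_shapes (d : Bool → Bool) (c : Box) :
    InDiagram (shapes d) c ↔ ∃ p, box d p = c := by
  rcases c with ⟨s, c⟩
  have : InDiagram (shapes d) (s, c) ↔ c ∈ shape (d s) := by
    cases s <;> simp [InDiagram]
  rw [this, mem_shape]
  simp [box, Prod.ext_iff]

theorem box_injective (d : Bool → Bool) : Function.Injective (box d) := by
  rintro ⟨s, j⟩ ⟨s', j'⟩ h
  obtain ⟨rfl, h⟩ := Prod.ext_iff.mp h
  cases hd : d s <;> cases j <;> cases j' <;> simp_all [box]

/-- The condition on `f` for `box d ∘ f` to be a standard double tableau. -/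
abbrev IsStandardFilling (f : Fin 4 → Bool × Bool) : Prop :=
  (∀ p, ∃ k, f k = p) ∧ ∀ k k', (f k).1 = (f k').1 → (f k).2 ≤ (f k').2 → k ≤ k'

theorem isStandard_box_comp (d : Bool → Bool) (f : Fin 4 → Bool × Bool) :
    IsStandard (shapes d) (box d ∘ f) ↔ IsStandardFilling f := by
  simp only [IsStandard, inDiagram_shapes, Function.comp_apply, exists_apply_eq_apply,
    implies_true, true_and, forall_exists_index, forall_apply_eq_imp_iff, (box_injective d).eq_iff]
  refine and_congr_right fun _ => forall₂_congr fun k k' => ?_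
  rcases f k with ⟨s, j⟩
  rcases f k' with ⟨s', j'⟩
  simp only [box]
  constructor
  · rintro h rfl hj
    cases j <;> cases j'
    exacts [h rfl le_rfl le_rfl, h rfl (by split <;> simp) (by split <;> simp),
      absurd hj (by decide), h rfl le_rfl le_rfl]
  · rintro h rfl h1 h2
    apply h rfl
    cases hd : d s <;> cases j <;> cases j' <;> simp_all

/-- The filling with the entries `i` and `j` in the first component. -/
def filling (i j : Fin 4) (k : Fin 4) : Bool × Bool :=
  (decide (k ≠ i ∧ k ≠ j),
    decide (∃ k', k' < k ∧ (k' ≠ i ∧ k' ≠ j ↔ k ≠ i ∧ k ≠ j)))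

theorem exists_filling {d : Bool → Bool} {t : Fin 4 → Box} (ht : IsStandard (shapes d) t) :
    ∃ f, IsStandardFilling f ∧ t = box d ∘ f := by
  choose f hf using fun k => (inDiagram_shapes d _).mp (ht.1 k)
  have : t = box d ∘ f := funext fun k => (hf k).symm
  exact ⟨f, (isStandard_box_comp d f).mp (this ▸ ht), this⟩

set_option maxRecDepth 10000 in
theorem eq_filling {f : Fin 4 → Bool × Bool} (hf : IsStandardFilling f) :
    f = filling 0 1 ∨ f = filling 0 2 ∨ f = filling 0 3 ∨ f = filling 1 2 ∨ f = filling 1 3 ∨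
      f = filling 2 3 := by
  have key : ∀ a b c e : Bool × Bool, IsStandardFilling ![a, b, c, e] →
    ![a, b, c, e] = filling 0 1 ∨ ![a, b, c, e] = filling 0 2 ∨ ![a, b, c, e] = filling 0 3 ∨
    ![a, b, c, e] = filling 1 2 ∨ ![a, b, c, e] = filling 1 3 ∨ ![a, b, c, e] = filling 2 3 := by
    decide
  have : f = ![f 0, f 1, f 2, f 3] := by ext k <;> fin_cases k <;> rfl
  rw [this] at hf ⊢
  exact key _ _ _ _ hf

end Specht
/-! ### The action on the standard double tableaux -/

namespace Specht

variable {K : Type*} [Field K]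

/-- The basis vector of the tableau with the entries `i < j` in the first component. -/
noncomputable def basisVec (K : Type*) [Field K] (d : Bool → Bool) (i j : Fin 4) :
    Space K (shapes d) :=
  vec K (shapes d) (box d ∘ filling i j)

/-- The eigenvalue of a generator on a row (`false`) or a column (`true`) of two boxes. -/
def lineEigenvalue (r : K) (b : Bool) : K := if b then -r⁻¹ else r

/-- The ratio of the contents of the second and the first box of a row or a column. -/
def lineRatio (r : K) (b : Bool) : K := if b then (r ^ 2)⁻¹ else r ^ 2

theorem vec_of_isStandard {D : DoublePartition} {t : Fin 4 → Box} (h : IsStandard D t) :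
    vec K D t = Finsupp.single ⟨t, h⟩ 1 := dif_pos h

theorem vec_of_not_isStandard {D : DoublePartition} {t : Fin 4 → Box} (h : ¬IsStandard D t) :
    vec K D t = 0 := dif_neg h

theorem content_box (r : K) (d : Bool → Bool) (p : Bool × Bool) :
    content r (box d p) =
      (if p.1 then -1 else 1) * (if p.2 then lineRatio r (d p.1) else 1) := by
  rcases p with ⟨s, j⟩
  cases j <;> cases h : d s <;> simp [content, sign, box, lineRatio, h]

theorem adjacentOp_vec (r : K) {d : Bool → Bool} {f : Fin 4 → Bool × Bool}
    (hf : IsStandardFilling f) (k : Fin 3) :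
    adjacentOp r (shapes d) k (vec K (shapes d) (box d ∘ f)) =
      diagCoeff r (box d ∘ f) k • vec K (shapes d) (box d ∘ f) +
        (r⁻¹ + diagCoeff r (box d ∘ f) k) •
          vec K (shapes d) (box d ∘ (f ∘ Equiv.swap k.castSucc k.succ)) := by
  conv_lhs => rw [vec_of_isStandard ((isStandard_box_comp d f).mpr hf)]
  rw [adjacentOp, Finsupp.linearCombination_single, one_smul]
  rfl

theorem signOp_vec {d : Bool → Bool} {f : Fin 4 → Bool × Bool} (hf : IsStandardFilling f) :
    signOp K (shapes d) (vec K (shapes d) (box d ∘ f)) =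
      (if (f 0).1 then -1 else 1 : K) • vec K (shapes d) (box d ∘ f) := by
  conv_lhs => rw [vec_of_isStandard ((isStandard_box_comp d f).mpr hf)]
  rw [signOp, Finsupp.linearCombination_single, one_smul]
  rfl

/-- Two consecutive entries in the same component. -/
theorem adjacentOp_basisVec_of_eq {r : K} (hr : r ≠ 0) (hr1 : r ^ 2 ≠ 1) (d : Bool → Bool)
    {i j : Fin 4} {k : Fin 3} (s : Bool) (hf : IsStandardFilling (filling i j))
    (hk : filling i j k.castSucc = (s, false)) (hk' : filling i j k.succ = (s, true))
    (hswap : ¬IsStandardFilling (filling i j ∘ Equiv.swap k.castSucc k.succ)) :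
    adjacentOp r (shapes d) k (basisVec K d i j) = lineEigenvalue r (d s) • basisVec K d i j := by
  rw [basisVec, adjacentOp_vec r hf, vec_of_not_isStandard fun h =>
    hswap ((isStandard_box_comp d _).mp h), smul_zero, add_zero]
  congr 1
  rw [diagCoeff, Function.comp_apply, Function.comp_apply, hk, hk', content_box, content_box]
  have hr1' : r ^ 2 - 1 ≠ 0 := sub_ne_zero.mpr hr1
  have hr1'' : 1 - r ^ 2 ≠ 0 := sub_ne_zero.mpr hr1.symm
  cases s <;> cases hd : d _ <;> simp [lineRatio, lineEigenvalue] <;> field_simp <;> ring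

/-- Two consecutive entries in different components. -/
theorem adjacentOp_basisVec_of_ne {r a : K} (d : Bool → Bool) {i j i' j' : Fin 4} {k : Fin 3}
    (hf : IsStandardFilling (filling i j))
    (hswap : filling i j ∘ Equiv.swap k.castSucc k.succ = filling i' j')
    (ha : content r (box d (filling i j k.castSucc)) / content r (box d (filling i j k.succ)) =
      -a) :
    adjacentOp r (shapes d) k (basisVec K d i j) =
      ((r - r⁻¹) / (1 + a)) • basisVec K d i j +
        (r⁻¹ + (r - r⁻¹) / (1 + a)) • basisVec K d i' j' := by
  rw [basisVec, adjacentOp_vec r hf, hswap]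
  have : diagCoeff r (box d ∘ filling i j) k = (r - r⁻¹) / (1 + a) := by
    rw [diagCoeff, Function.comp_apply, Function.comp_apply, ha, sub_neg_eq_add]
  rw [this]
  rfl

theorem signOp_basisVec (d : Bool → Bool) {i j : Fin 4} (hf : IsStandardFilling (filling i j)) :
    signOp K (shapes d) (basisVec K d i j) =
      (if (filling i j 0).1 then -1 else 1 : K) • basisVec K d i j :=
  signOp_vec hf

theorem adjacentOp_zero_basisVec {r : K} (hr : r ≠ 0) (hr1 : r ^ 2 ≠ 1) (d : Bool → Bool) :
    adjacentOp r (shapes d) 0 (basisVec K d 0 1) =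
        lineEigenvalue r (d false) • basisVec K d 0 1 ∧
      adjacentOp r (shapes d) 0 (basisVec K d 2 3) =
        lineEigenvalue r (d true) • basisVec K d 2 3 ∧
      adjacentOp r (shapes d) 0 (basisVec K d 0 2) = ((r - r⁻¹) / (1 + 1)) • basisVec K d 0 2 +
        (r⁻¹ + (r - r⁻¹) / (1 + 1)) • basisVec K d 1 2 ∧
      adjacentOp r (shapes d) 0 (basisVec K d 1 2) = ((r - r⁻¹) / (1 + 1)) • basisVec K d 1 2 +
        (r⁻¹ + (r - r⁻¹) / (1 + 1)) • basisVec K d 0 2 ∧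
      adjacentOp r (shapes d) 0 (basisVec K d 0 3) = ((r - r⁻¹) / (1 + 1)) • basisVec K d 0 3 +
        (r⁻¹ + (r - r⁻¹) / (1 + 1)) • basisVec K d 1 3 ∧
      adjacentOp r (shapes d) 0 (basisVec K d 1 3) = ((r - r⁻¹) / (1 + 1)) • basisVec K d 1 3 +
        (r⁻¹ + (r - r⁻¹) / (1 + 1)) • basisVec K d 0 3 := by
  refine ⟨adjacentOp_basisVec_of_eq hr hr1 d false (by decide) (by decide) (by decide) (by decide),
    adjacentOp_basisVec_of_eq hr hr1 d true (by decide) (by decide) (by decide) (by decide),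
    adjacentOp_basisVec_of_ne d (by decide) (by decide) ?_,
    adjacentOp_basisVec_of_ne d (by decide) (by decide) ?_,
    adjacentOp_basisVec_of_ne d (by decide) (by decide) ?_,
    adjacentOp_basisVec_of_ne d (by decide) (by decide) ?_⟩ <;>
  rw [content_box, content_box] <;> simp [filling]

theorem adjacentOp_one_basisVec {r : K} (hr : r ≠ 0) (hr1 : r ^ 2 ≠ 1) (d : Bool → Bool) :
    adjacentOp r (shapes d) 1 (basisVec K d 0 1) =
        ((r - r⁻¹) / (1 + lineRatio r (d false))) • basisVec K d 0 1 +
          (r⁻¹ + (r - r⁻¹) / (1 + lineRatio r (d false))) • basisVec K d 0 2 ∧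
      adjacentOp r (shapes d) 1 (basisVec K d 2 3) =
        ((r - r⁻¹) / (1 + lineRatio r (d true))) • basisVec K d 2 3 +
          (r⁻¹ + (r - r⁻¹) / (1 + lineRatio r (d true))) • basisVec K d 1 3 ∧
      adjacentOp r (shapes d) 1 (basisVec K d 0 2) =
        ((r - r⁻¹) / (1 + (lineRatio r (d false))⁻¹)) • basisVec K d 0 2 +
          (r⁻¹ + (r - r⁻¹) / (1 + (lineRatio r (d false))⁻¹)) • basisVec K d 0 1 ∧
      adjacentOp r (shapes d) 1 (basisVec K d 1 3) =
        ((r - r⁻¹) / (1 + (lineRatio r (d true))⁻¹)) • basisVec K d 1 3 +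
          (r⁻¹ + (r - r⁻¹) / (1 + (lineRatio r (d true))⁻¹)) • basisVec K d 2 3 ∧
      adjacentOp r (shapes d) 1 (basisVec K d 0 3) =
        lineEigenvalue r (d true) • basisVec K d 0 3 ∧
      adjacentOp r (shapes d) 1 (basisVec K d 1 2) =
        lineEigenvalue r (d false) • basisVec K d 1 2 := by
  refine ⟨adjacentOp_basisVec_of_ne d (by decide) (by decide) ?_,
    adjacentOp_basisVec_of_ne d (by decide) (by decide) ?_,
    adjacentOp_basisVec_of_ne d (by decide) (by decide) ?_,
    adjacentOp_basisVec_of_ne d (by decide) (by decide) ?_,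
    adjacentOp_basisVec_of_eq hr hr1 d true (by decide) (by decide) (by decide) (by decide),
    adjacentOp_basisVec_of_eq hr hr1 d false (by decide) (by decide) (by decide) (by decide)⟩
  · rw [content_box, content_box]
    simp [show filling 0 1 1 = (false, true) by decide,
      show filling 0 1 2 = (true, false) by decide,
      div_neg]
  · rw [content_box, content_box]
    simp [show filling 2 3 1 = (true, true) by decide,
      show filling 2 3 2 = (false, false) by decide]
  · rw [content_box, content_box]
    simp [show filling 0 2 1 = (true, false) by decide,
      show filling 0 2 2 = (false, true) by decide,
      neg_div]
  · rw [content_box, content_box]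
    simp [show filling 1 3 1 = (false, false) by decide,
      show filling 1 3 2 = (true, true) by decide,
      div_neg]

theorem adjacentOp_two_basisVec {r : K} (hr : r ≠ 0) (hr1 : r ^ 2 ≠ 1) (d : Bool → Bool) :
    adjacentOp r (shapes d) 2 (basisVec K d 0 1) =
        lineEigenvalue r (d true) • basisVec K d 0 1 ∧
      adjacentOp r (shapes d) 2 (basisVec K d 2 3) =
        lineEigenvalue r (d false) • basisVec K d 2 3 :=
  ⟨adjacentOp_basisVec_of_eq hr hr1 d true (by decide) (by decide) (by decide) (by decide),
    adjacentOp_basisVec_of_eq hr hr1 d false (by decide) (by decide) (by decide) (by decide)⟩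

theorem adjacentOp_two_basisVec_const {r : K} (hr : r ≠ 0) (c : Bool) :
    let d : Bool → Bool := fun _ => c
    adjacentOp r (shapes d) 2 (basisVec K d 0 2) = ((r - r⁻¹) / (1 + 1)) • basisVec K d 0 2 +
        (r⁻¹ + (r - r⁻¹) / (1 + 1)) • basisVec K d 0 3 ∧
      adjacentOp r (shapes d) 2 (basisVec K d 0 3) = ((r - r⁻¹) / (1 + 1)) • basisVec K d 0 3 +
        (r⁻¹ + (r - r⁻¹) / (1 + 1)) • basisVec K d 0 2 ∧
      adjacentOp r (shapes d) 2 (basisVec K d 1 2) = ((r - r⁻¹) / (1 + 1)) • basisVec K d 1 2 +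
        (r⁻¹ + (r - r⁻¹) / (1 + 1)) • basisVec K d 1 3 ∧
      adjacentOp r (shapes d) 2 (basisVec K d 1 3) = ((r - r⁻¹) / (1 + 1)) • basisVec K d 1 3 +
        (r⁻¹ + (r - r⁻¹) / (1 + 1)) • basisVec K d 1 2 := by
  have hq : lineRatio r c ≠ 0 := by cases c <;> simp [lineRatio, hr]
  refine ⟨adjacentOp_basisVec_of_ne _ (by decide) (by decide) ?_,
    adjacentOp_basisVec_of_ne _ (by decide) (by decide) ?_,
    adjacentOp_basisVec_of_ne _ (by decide) (by decide) ?_,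
    adjacentOp_basisVec_of_ne _ (by decide) (by decide) ?_⟩ <;>
  rw [content_box, content_box]
  · simp [show filling 0 2 2 = (false, true) by decide, show filling 0 2 3 = (true, true) by decide,
      hq]
  · simp [show filling 0 3 2 = (true, true) by decide, show filling 0 3 3 = (false, true) by decide,
      hq]
  · simp [show filling 1 2 2 = (false, true) by decide, show filling 1 2 3 = (true, true) by decide,
      hq]
  · simp [show filling 1 3 2 = (true, true) by decide, show filling 1 3 3 = (false, true) by decide,
      hq]

theorem signOp_basisVec_all (d : Bool → Bool) :
    signOp K (shapes d) (basisVec K d 0 1) = basisVec K d 0 1 ∧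
      signOp K (shapes d) (basisVec K d 0 2) = basisVec K d 0 2 ∧
      signOp K (shapes d) (basisVec K d 0 3) = basisVec K d 0 3 ∧
      signOp K (shapes d) (basisVec K d 1 2) = -basisVec K d 1 2 ∧
      signOp K (shapes d) (basisVec K d 1 3) = -basisVec K d 1 3 ∧
      signOp K (shapes d) (basisVec K d 2 3) = -basisVec K d 2 3 := by
  refine ⟨?_, ?_, ?_, ?_, ?_, ?_⟩ <;> rw [signOp_basisVec d (by decide)] <;> simp [filling]

theorem basisVec_apply (d : Bool → Bool) {i j i' j' : Fin 4}
    (hf : IsStandardFilling (filling i j)) (h : IsStandard (shapes d) (box d ∘ filling i' j')) :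
    basisVec K d i j ⟨box d ∘ filling i' j', h⟩ = if filling i j = filling i' j' then 1 else 0 := by
  rw [basisVec, vec_of_isStandard ((isStandard_box_comp d _).mpr hf), Finsupp.single_apply]
  simp only [Subtype.mk.injEq, (box_injective d).comp_left.eq_iff]

theorem exchange_basisVec (c : Bool) {i j i' j' : Fin 4} (hf : IsStandardFilling (filling i j))
    (h : (fun k => (!(filling i j k).1, (filling i j k).2)) = filling i' j') :
    exchange K (shape c) (basisVec K (fun _ => c) i j) = basisVec K (fun _ => c) i' j' := by
  conv_lhs => rw [basisVec, vec_of_isStandard ((isStandard_box_comp _ _).mpr hf)]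
  rw [exchange]
  erw [Finsupp.linearCombination_single]
  rw [one_smul, basisVec, ← h]
  rfl

theorem exchange_basisVec_all (c : Bool) :
    let d : Bool → Bool := fun _ => c
    exchange K (shape c) (basisVec K d 0 1) = basisVec K d 2 3 ∧
      exchange K (shape c) (basisVec K d 0 2) = basisVec K d 1 3 ∧
      exchange K (shape c) (basisVec K d 0 3) = basisVec K d 1 2 ∧
      exchange K (shape c) (basisVec K d 1 2) = basisVec K d 0 3 ∧
      exchange K (shape c) (basisVec K d 1 3) = basisVec K d 0 2 ∧
      exchange K (shape c) (basisVec K d 2 3) = basisVec K d 0 1 := by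
  refine ⟨?_, ?_, ?_, ?_, ?_, ?_⟩ <;> exact exchange_basisVec c (by decide) (by decide)

/-- The basis of `S^{(λ,λ)±}` formed by the sums of a tableau with the entry `0` in the first
component and `±` its image under the exchange of the components. -/
noncomputable def halfVec (K : Type*) [Field K] (c : Bool) (ε : ℤˣ) :
    Fin 3 → Space K (shapes fun _ => c) :=
  ![basisVec K _ 0 1 + ((ε : ℤ) : K) • basisVec K _ 2 3,
    basisVec K _ 0 2 + ((ε : ℤ) : K) • basisVec K _ 1 3,
    basisVec K _ 0 3 + ((ε : ℤ) : K) • basisVec K _ 1 2]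

theorem halfVec_mem (c : Bool) (ε : ℤˣ) (j : Fin 3) : halfVec K c ε j ∈ half K (shape c) ε := by
  rw [half, Module.End.mem_eigenspace_iff]
  obtain ⟨e1, e2, e3, e4, e5, e6⟩ := exchange_basisVec_all (K := K) c
  obtain rfl | rfl := Int.units_eq_one_or ε <;> fin_cases j <;>
    simp only [halfVec, Fin.zero_eta, Fin.mk_one, Fin.reduceFinMk, Matrix.cons_val, map_add,
      map_smul, e1, e2, e3, e4, e5, e6] <;> simp [add_comm]

theorem half_le_span [CharZero K] (c : Bool) (ε : ℤˣ) :
    half K (shape c) ε ≤ Submodule.span K (Set.range (halfVec K c ε)) := by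
  have hεε : ((ε : ℤ) : K) * ((ε : ℤ) : K) = 1 := by
    obtain rfl | rfl := Int.units_eq_one_or ε <;> simp
  -- The projection to the eigenspace maps each basis vector into the span.
  have key (z : Space K (shape c, shape c)) : z + ((ε : ℤ) : K) • exchange K (shape c) z ∈
      Submodule.span K (Set.range (halfVec K c ε)) := by
    induction z using Finsupp.induction_linear with
    | zero => simp
    | add z z' hz hz' =>
      convert add_mem hz hz' using 1
      rw [map_add, smul_add]
      abel
    | single t a =>
      have hmem (j) (b : K) : b • halfVec K c ε j ∈
          Submodule.span K (Set.range (halfVec K c ε)) :=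
        Submodule.smul_mem _ _ (Submodule.subset_span ⟨j, rfl⟩)
      obtain ⟨t, ht⟩ := t
      obtain ⟨f, hf, rfl⟩ := exists_filling (d := fun _ => c) ht
      have hvec : Finsupp.single (⟨_, ht⟩ : Tableau (shapes fun _ => c)) a =
          a • vec K (shapes fun _ => c) (box (fun _ => c) ∘ f) := by
        rw [vec_of_isStandard ht, Finsupp.smul_single, smul_eq_mul, mul_one]
      obtain ⟨e1, e2, e3, e4, e5, e6⟩ := exchange_basisVec_all (K := K) c
      rw [hvec, map_smul]
      obtain rfl | rfl | rfl | rfl | rfl | rfl := eq_filling hf <;>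
        rw [← basisVec]
      · convert hmem 0 a using 1
        rw [e1]
        simp only [halfVec, Matrix.cons_val]
        module
      · convert hmem 1 a using 1
        rw [e2]
        simp only [halfVec, Matrix.cons_val]
        module
      · convert hmem 2 a using 1
        rw [e3]
        simp only [halfVec, Matrix.cons_val]
        module
      · convert hmem 2 (a * ((ε : ℤ) : K)) using 1
        rw [e4]
        simp only [halfVec, Matrix.cons_val]
        simp only [smul_add, smul_smul, mul_assoc, hεε]
        module
      · convert hmem 1 (a * ((ε : ℤ) : K)) using 1
        rw [e5]
        simp only [halfVec, Matrix.cons_val]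
        simp only [smul_add, smul_smul, mul_assoc, hεε]
        module
      · convert hmem 0 (a * ((ε : ℤ) : K)) using 1
        rw [e6]
        simp only [halfVec, Matrix.cons_val]
        simp only [smul_add, smul_smul, mul_assoc, hεε]
        module
  intro z hz
  rw [half, Module.End.mem_eigenspace_iff] at hz
  have := key z
  rw [hz, smul_smul, hεε, one_smul, ← two_smul K z] at this
  exact (Submodule.smul_mem_iff _ two_ne_zero).mp this

theorem g_halfVec {r : K} (hr : r ≠ 0) (hr1 : r ^ 2 ≠ 1) (c : Bool) (ε : ℤˣ) :
    let G := g r (shapes fun _ => c)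
    let y := halfVec K c ε
    let a := (r - r⁻¹) / (1 + 1)
    let b := (r - r⁻¹) / (1 + lineRatio r c)
    let b' := (r - r⁻¹) / (1 + (lineRatio r c)⁻¹)
    (G 0 (y 0) = lineEigenvalue r c • y 0 ∧
      G 0 (y 1) = a • y 1 - (((ε : ℤ) : K) * (r⁻¹ + a)) • y 2 ∧
      G 0 (y 2) = a • y 2 - (((ε : ℤ) : K) * (r⁻¹ + a)) • y 1) ∧
    (G 1 (y 0) = lineEigenvalue r c • y 0 ∧
      G 1 (y 1) = a • y 1 + (((ε : ℤ) : K) * (r⁻¹ + a)) • y 2 ∧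
      G 1 (y 2) = a • y 2 + (((ε : ℤ) : K) * (r⁻¹ + a)) • y 1) ∧
    (G 2 (y 0) = b • y 0 + (r⁻¹ + b) • y 1 ∧
      G 2 (y 1) = b' • y 1 + (r⁻¹ + b') • y 0 ∧
      G 2 (y 2) = lineEigenvalue r c • y 2) ∧
    (G 3 (y 0) = lineEigenvalue r c • y 0 ∧
      G 3 (y 1) = a • y 1 + (r⁻¹ + a) • y 2 ∧
      G 3 (y 2) = a • y 2 + (r⁻¹ + a) • y 1) := by
  intro G y a b b'
  obtain ⟨z1, z2, z3, z4, z5, z6⟩ := adjacentOp_zero_basisVec hr hr1 (fun _ => c)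
  obtain ⟨o1, o2, o3, o4, o5, o6⟩ := adjacentOp_one_basisVec hr hr1 (fun _ => c)
  obtain ⟨t1, t2⟩ := adjacentOp_two_basisVec hr hr1 (fun _ => c)
  obtain ⟨t3, t4, t5, t6⟩ := adjacentOp_two_basisVec_const hr c
  obtain ⟨s1, s2, s3, s4, s5, s6⟩ := signOp_basisVec_all (K := K) (fun _ => c)
  refine ⟨?_, ?_, ?_, ?_⟩ <;> refine ⟨?_, ?_, ?_⟩ <;>
    obtain rfl | rfl := Int.units_eq_one_or ε <;>
    simp only [G, y, g, halfVec, Matrix.cons_val, Module.End.mul_apply, map_add, map_smul,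
      map_neg, smul_neg, z1, z2, z3, z4, z5, z6, o1, o2, o3, o4, o5, o6, t1, t2, t3, t4, t5, t6,
      s1, s2, s3, s4, s5, s6, Units.val_one, Units.val_neg, Int.cast_one, Int.cast_neg] <;>
    module

theorem halfVec_ne_zero (c : Bool) (ε : ℤˣ) :
    halfVec K c ε 0 ≠ 0 ∧ halfVec K c ε 1 - halfVec K c ε 2 ≠ 0 := by
  simp only [halfVec, Matrix.cons_val]
  constructor <;> intro h
  · have := congrArg (fun z => z ⟨box (fun _ => c) ∘ filling 0 1,
      (isStandard_box_comp _ _).mpr (by decide)⟩) h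
    simp only [Finsupp.add_apply, Finsupp.smul_apply, Finsupp.zero_apply] at this
    rw [basisVec_apply _ (by decide), basisVec_apply _ (by decide), if_pos rfl,
      if_neg (by decide)] at this
    simp at this
  · have := congrArg (fun z => z ⟨box (fun _ => c) ∘ filling 0 2,
      (isStandard_box_comp _ _).mpr (by decide)⟩) h
    simp only [Finsupp.add_apply, Finsupp.sub_apply, Finsupp.smul_apply,
      Finsupp.zero_apply] at this
    rw [basisVec_apply _ (by decide), basisVec_apply _ (by decide), basisVec_apply _ (by decide),
      basisVec_apply _ (by decide), if_pos rfl, if_neg (by decide), if_neg (by decide),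
      if_neg (by decide)] at this
    simp at this

/-- A reflection triple in `S^{(2,2)±}`. -/
noncomputable def rowTriple (r : K) (ε : ℤˣ) : Fin 3 → Space K (shapes fun _ => false) :=
  let y := halfVec K false ε
  let b := (r - r⁻¹) / (1 + (r ^ 2)⁻¹)
  ![y 1 + y 2, (b - r) • y 1 + (r⁻¹ + b) • y 0, y 1 - y 2]

theorem isReflectionTriple_rowTriple [CharZero K] {r : K} (hr : r ≠ 0) (hr1 : r ^ 2 ≠ 1)
    (hr2 : r ^ 2 ≠ -1) (ε : ℤˣ) :
    IsReflectionTriple (g r (shapes fun _ => false)) r (CohenWales.fold ε) (rowTriple r ε) := by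
  have h := g_halfVec hr hr1 false ε
  simp only [lineEigenvalue, lineRatio, Bool.false_eq_true, if_false] at h
  have hr2' : r ^ 2 + 1 ≠ 0 := fun H => hr2 (by linear_combination H)
  have hr2'' : 1 + r ^ 2 ≠ 0 := fun H => hr2 (by linear_combination H)
  generalize hy : halfVec K false ε = y at h
  obtain ⟨⟨a0, a1, a2⟩, ⟨b0, b1, b2⟩, ⟨c0, c1, c2⟩, ⟨d0, d1, d2⟩⟩ := h
  intro i j
  simp only [rowTriple, hy]
  obtain rfl | rfl := Int.units_eq_one_or ε <;> fin_cases i <;> fin_cases j <;>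
    simp only [CohenWales.fold, show ¬((-1 : ℤˣ) = 1) by decide, if_true, if_false, Fin.zero_eta,
      Fin.mk_one, Fin.reduceFinMk, Matrix.cons_val, reflectionMatrix, Matrix.of_apply, map_add,
      map_sub, map_smul, a0, a1, a2, b0, b1, b2, c0, c1, c2, d0, d1, d2, Units.val_one,
      Units.val_neg, Int.cast_one, Int.cast_neg] <;>
    match_scalars <;> field_simp <;> ring

theorem range_rowTriple [CharZero K] {r : K} (hr : r ≠ 0) (hr1 : r ^ 2 ≠ 1)
    (hr2 : r ^ 2 ≠ -1) (hr4 : r ^ 4 ≠ -1) (ε : ℤˣ) :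
    LinearMap.range (Fintype.linearCombination K (rowTriple r ε)) = half K (shape false) ε := by
  have hle := half_le_span (K := K) false ε
  have hfin : FiniteDimensional K (Submodule.span K (Set.range (halfVec K false ε))) :=
    FiniteDimensional.span_of_finite K (Set.finite_range _)
  have : FiniteDimensional K (half K (shape false) ε) := Submodule.finiteDimensional_of_le hle
  have hy := halfVec_mem (K := K) false ε
  refine (isReflectionTriple_rowTriple hr hr1 hr2 ε).range_eq_of_finrank_le
    (CohenWales.fold_surjective ε) (halfVec_ne_zero false ε).2 hr hr2 hr4 (fun j => ?_)
    ((Submodule.finrank_mono hle).trans ((finrank_range_le_card _).trans (by simp)))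
  fin_cases j
  · exact add_mem (hy 1) (hy 2)
  · exact add_mem (Submodule.smul_mem _ _ (hy 1)) (Submodule.smul_mem _ _ (hy 0))
  · exact sub_mem (hy 1) (hy 2)

end Specht
/-! ### Occurrence of the Specht modules in the Cohen-Wales space -/

/-- An isomorphism of `S` with a subspace of `V`, as an equivariant injective map into `V`. -/
theorem AreIsomorphicSubspaces.exists_linearMap {ι K V M : Type*} [Field K] [AddCommGroup V]
    [Module K V] [AddCommGroup M] [Module K M] {g : ι → Module.End K V} {X : Submodule K V}
    {h : ι → Module.End K M} {S : Submodule K M} (H : AreIsomorphicSubspaces g X h S) :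
    ∃ ψ : S →ₗ[K] V, (∀ s, s ≠ 0 → ψ s ≠ 0) ∧ (∀ s, ψ s ∈ X) ∧
      ∀ (i : ι) (s s' : S), h i (s : M) = (s' : M) → g i (ψ s) = ψ s' := by
  obtain ⟨hX, -, φ, hφ⟩ := H
  refine ⟨X.subtype ∘ₗ φ.symm.toLinearMap, fun s hs => by simpa using hs,
    fun s => (φ.symm s).2, fun i s s' hs => ?_⟩
  have := hφ i (φ.symm s) ⟨g i (φ.symm s), hX i _ (φ.symm s).2⟩ rfl
  rw [LinearEquiv.apply_symm_apply, hs] at this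
  have := congrArg φ.symm (Subtype.ext this)
  rw [LinearEquiv.symm_apply_apply] at this
  exact congrArg Subtype.val this

section

open CohenWales Specht

variable {K : Type*} [Field K]

theorem eq_zero_of_add_of_sub [CharZero K] (f : CWSpace K →ₗ[K] K) {v w : CWSpace K}
    (h : f (v + w) = 0) (h' : f (v - w) = 0) : f v = 0 := by
  rw [map_add] at h
  rw [map_sub] at h'
  linear_combination (h + h') / 2

/-- A subspace isomorphic to `S^{(2,2)±}` contains a joint eigenvector that lies in `𝒰` or `𝒲`, and
it exists only if `l = 1 / r`. -/
theorem eq_one_div_and_exists_mem_of_row [CharZero K] {l r : K} (hl : l ≠ 0) (hr : r ≠ 0)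
    (hr1 : r ^ 2 ≠ 1) (hr2 : r ^ 2 ≠ -1) (hr4 : r ^ 4 ≠ -1) {ε : ℤˣ}
    {X : Submodule K (CWSpace K)}
    (H : AreIsomorphicSubspaces (CohenWales.g l r) X (Specht.g r (shapes fun _ => false))
      (half K (shape false) ε)) :
    l = 1 / r ∧ ∃ v ∈ X, v ∈ subspaceUW r ε ∧ v ≠ 0 := by
  obtain ⟨ψ, hψ, hX, hg⟩ := H.exists_linearMap
  have hn := neg_inv_ne hr hr2
  have hr2' : r ^ 2 + 1 ≠ 0 := fun H => hr2 (by linear_combination H)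
  have h := g_halfVec hr hr1 false ε
  have hy := halfVec_mem (K := K) false ε
  have hne := (halfVec_ne_zero (K := K) false ε).2
  simp only [lineEigenvalue, lineRatio, Bool.false_eq_true, if_false] at h
  generalize halfVec K false ε = y at h hy hne
  obtain ⟨⟨a0, a1, a2⟩, ⟨b0, b1, b2⟩, ⟨c0, c1, c2⟩, ⟨d0, d1, d2⟩⟩ := h
  let Y (j : Fin 3) : half K (shape false) ε := ⟨y j, hy j⟩
  have h0 : CohenWales.g l r 3 (ψ (Y 0)) = r • ψ (Y 0) := by
    rw [← map_smul]
    exact hg 3 _ _ d0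
  have hs : CohenWales.g l r 3 (ψ (Y 1) + ψ (Y 2)) = r • (ψ (Y 1) + ψ (Y 2)) := by
    rw [← map_add, ← map_smul]
    refine hg 3 _ _ ?_
    simp only [Y, Submodule.coe_add, Submodule.coe_smul, map_add, d1, d2]
    match_scalars <;> field_simp <;> ring
  have hd : IsJointEigenvector (CohenWales.g l r) (if ε = 1 then r else -r⁻¹)
      (if ε = 1 then -r⁻¹ else r) (-r⁻¹) (ψ (Y 1) - ψ (Y 2)) := by
    refine ⟨?_, ?_, ?_⟩ <;> rw [← map_sub, ← map_smul] <;> refine hg _ _ _ ?_ <;>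
      simp only [Y, AddSubgroupClass.coe_sub, Submodule.coe_smul, map_sub, a1, a2, b1, b2, d1, d2]
    · obtain rfl | rfl := Int.units_eq_one_or ε <;> simp <;> match_scalars <;> field_simp <;> ring
    · obtain rfl | rfl := Int.units_eq_one_or ε <;> simp <;> match_scalars <;> field_simp <;> ring
    · match_scalars <;> field_simp <;> ring
  have h2 : CohenWales.g l r 2 (ψ (Y 1) - ψ (Y 2)) =
      ((r - r⁻¹) / (1 + (r ^ 2)⁻¹)) • ψ (Y 1) +
        (r⁻¹ + (r - r⁻¹) / (1 + (r ^ 2)⁻¹)) • ψ (Y 0) - r • ψ (Y 2) := by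
    rw [map_sub]
    congr 1
    · rw [← map_smul, ← map_smul, ← map_add]
      exact hg 2 _ _ c1
    · rw [← map_smul]
      exact hg 2 _ _ c2
  have hv0 : ψ (Y 1) - ψ (Y 2) ≠ 0 := by
    rw [← map_sub]
    exact hψ _ fun h => hne (congrArg Subtype.val h)
  refine ⟨?_, _, sub_mem (hX (Y 1)) (hX (Y 2)), hd.mem_subspaceUW hr hr2 hr4, hv0⟩
  refine hd.eq_one_div hl hr hr2
    (by obtain rfl | rfl := Int.units_eq_one_or ε <;> simp) hv0 ?_
  have hf := eigenform_g (l := l) (α := if ε = 1 then r else -r⁻¹)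
    (β := if ε = 1 then -r⁻¹ else r) (γ := -r⁻¹) hr
    (by obtain rfl | rfl := Int.units_eq_one_or ε <;> simp)
    (by obtain rfl | rfl := Int.units_eq_one_or ε <;> simp) (Or.inr rfl) (Or.inr (Or.inr rfl))
  generalize eigenform (K := K) _ _ _ = f at hf ⊢
  have f0 : f (ψ (Y 0)) = 0 := eq_zero_of_eigenvalue_ne (fun v => (hf v).2.2) h0 hn
  have fs : f (ψ (Y 1) + ψ (Y 2)) = 0 := eq_zero_of_eigenvalue_ne (fun v => (hf v).2.2) hs hn
  rw [map_add] at fs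
  rw [h2]
  simp only [map_sub, map_add, map_smul, smul_eq_mul, f0, eq_neg_of_add_eq_zero_right fs]
  field_simp
  ring

/-- The modules `S^{(1²,1²)±}` are not isomorphic to a subspace of `V₄`: the image of the tableau
with both columns in order would be a joint eigenvector for `-r⁻¹`. -/
theorem not_areIsomorphicSubspaces_column [CharZero K] {l r : K} (hl : l ≠ 0) (hr : r ≠ 0)
    (hr1 : r ^ 2 ≠ 1) (hr2 : r ^ 2 ≠ -1) (hr4 : r ^ 4 ≠ -1) (ε : ℤˣ)
    (X : Submodule K (CWSpace K)) :
    ¬AreIsomorphicSubspaces (CohenWales.g l r) X (Specht.g r (shapes fun _ => true))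
      (half K (shape true) ε) := fun H => by
  obtain ⟨ψ, hψ, -, hg⟩ := H.exists_linearMap
  have hn := neg_inv_ne hr hr2
  have hr2' : r ^ 2 + 1 ≠ 0 := fun H => hr2 (by linear_combination H)
  have hr2'' : 1 + r ^ 2 ≠ 0 := fun H => hr2 (by linear_combination H)
  have h := g_halfVec hr hr1 true ε
  have hy := halfVec_mem (K := K) true ε
  have hne := (halfVec_ne_zero (K := K) true ε).1
  simp only [lineEigenvalue, lineRatio, if_true, inv_inv] at h
  generalize halfVec K true ε = y at h hy hne
  obtain ⟨⟨a0, a1, a2⟩, ⟨b0, b1, b2⟩, ⟨c0, c1, c2⟩, ⟨d0, d1, d2⟩⟩ := h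
  let Y (j : Fin 3) : half K (shape true) ε := ⟨y j, hy j⟩
  have hv : IsJointEigenvector (CohenWales.g l r) (-r⁻¹) (-r⁻¹) (-r⁻¹) (ψ (Y 0)) := by
    refine ⟨?_, ?_, ?_⟩ <;> rw [← map_smul]
    exacts [hg _ _ _ a0, hg _ _ _ b0, hg _ _ _ d0]
  have hs : CohenWales.g l r 3 (ψ (Y 1) + ψ (Y 2)) = r • (ψ (Y 1) + ψ (Y 2)) := by
    rw [← map_add, ← map_smul]
    refine hg 3 _ _ ?_
    simp only [Y, Submodule.coe_add, Submodule.coe_smul, map_add, d1, d2]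
    match_scalars <;> field_simp <;> ring
  -- `y 1 ± y 2` are eigenvectors for `r` of one of `g₁, g₂, g₄`, so the eigenform kills `y 1`.
  have hd : CohenWales.g l r 0 (ψ (Y 1) - ψ (Y 2)) = r • (ψ (Y 1) - ψ (Y 2)) ∨
      CohenWales.g l r 1 (ψ (Y 1) - ψ (Y 2)) = r • (ψ (Y 1) - ψ (Y 2)) := by
    rw [← map_sub, ← map_smul]
    obtain rfl | rfl := Int.units_eq_one_or ε
    · left
      refine hg _ _ _ ?_
      simp only [Y, AddSubgroupClass.coe_sub, Submodule.coe_smul, map_sub, a1, a2]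
      simp
      match_scalars <;> field_simp <;> ring
    · right
      refine hg _ _ _ ?_
      simp only [Y, AddSubgroupClass.coe_sub, Submodule.coe_smul, map_sub, b1, b2]
      simp
      match_scalars <;> field_simp <;> ring
  have h20 : CohenWales.g l r 2 (ψ (Y 0)) =
      ((r - r⁻¹) / (1 + (r ^ 2)⁻¹)) • ψ (Y 0) + (r⁻¹ + (r - r⁻¹) / (1 + (r ^ 2)⁻¹)) • ψ (Y 1) := by
    rw [← map_smul, ← map_smul, ← map_add]
    exact hg 2 _ _ c0
  have h21 : CohenWales.g l r 2 (ψ (Y 1)) =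
      ((r - r⁻¹) / (1 + r ^ 2)) • ψ (Y 1) + (r⁻¹ + (r - r⁻¹) / (1 + r ^ 2)) • ψ (Y 0) := by
    rw [← map_smul, ← map_smul, ← map_add]
    exact hg 2 _ _ c1
  refine hψ (Y 0) (fun h => hne (congrArg Subtype.val h))
    (hv.eq_zero_of_neg_neg_neg hl hr hr2 hr4 ?_ ?_)
  · rw [h20, map_add, map_smul, map_smul, h20, h21]
    match_scalars <;> rw [m] <;> field_simp <;> ring
  · have hf := eigenform_g (l := l) (α := -r⁻¹) (β := -r⁻¹) (γ := -r⁻¹) hr (Or.inr rfl)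
      (Or.inr rfl) (Or.inr rfl) (Or.inl rfl)
    generalize eigenform (K := K) _ _ _ = f at hf ⊢
    have f1 : f (ψ (Y 1)) = 0 := by
      refine eq_zero_of_add_of_sub f (eq_zero_of_eigenvalue_ne (fun v => (hf v).2.2) hs hn) ?_
      obtain hd | hd := hd
      exacts [eq_zero_of_eigenvalue_ne (fun v => (hf v).1) hd hn,
        eq_zero_of_eigenvalue_ne (fun v => (hf v).2.1) hd hn]
    rw [h20]
    simp only [map_add, map_smul, smul_eq_mul, f1]
    field_simp
    ring

/-- The module `S^{(1,1),(2)}` is not isomorphic to a subspace of `V₄`: the image of the tableau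
with the column filled first would be a joint eigenvector for `-r⁻¹, -r⁻¹, r`. -/
theorem not_areIsomorphicSubspaces_column_row [CharZero K] {l r : K} (hl : l ≠ 0) (hr : r ≠ 0)
    (hr1 : r ^ 2 ≠ 1) (hr2 : r ^ 2 ≠ -1) (X : Submodule K (CWSpace K)) :
    ¬AreIsomorphicSubspaces (CohenWales.g l r) X (Specht.g r (shapes not)) ⊤ := fun H => by
  obtain ⟨ψ, hψ, -, hg⟩ := H.exists_linearMap
  have hn := neg_inv_ne hr hr2
  have hr2' : r ^ 2 + 1 ≠ 0 := fun H => hr2 (by linear_combination H)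
  have hr2'' : 1 + r ^ 2 ≠ 0 := fun H => hr2 (by linear_combination H)
  obtain ⟨z1, z2, z3, z4, -, -⟩ := adjacentOp_zero_basisVec hr hr1 not
  obtain ⟨o1, -, o3, -, -, -⟩ := adjacentOp_one_basisVec hr hr1 not
  obtain ⟨t1, -⟩ := adjacentOp_two_basisVec hr hr1 not
  obtain ⟨s1, s2, -, s4, -, -⟩ := signOp_basisVec_all (K := K) not
  simp only [lineEigenvalue, lineRatio, Bool.not_false, Bool.not_true, if_true, inv_inv,
    Bool.false_eq_true, if_false] at z1 o1 o3 t1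
  have hne : basisVec K not 0 1 ≠ 0 := by
    intro h
    have := congrArg (fun z => z ⟨box not ∘ filling 0 1,
      (isStandard_box_comp _ _).mpr (by decide)⟩) h
    rw [basisVec_apply _ (by decide), if_pos rfl] at this
    simp at this
  let Y (i j : Fin 4) : (⊤ : Submodule K (Space K (shapes not))) := ⟨basisVec K not i j, trivial⟩
  have hv : IsJointEigenvector (CohenWales.g l r) (-r⁻¹) (-r⁻¹) r (ψ (Y 0 1)) := by
    refine ⟨?_, ?_, ?_⟩ <;> rw [← map_smul] <;> refine hg _ _ _ ?_
    · simp only [Y, Specht.g, Matrix.cons_val, Module.End.mul_apply, s1, z1, map_smul,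
        Submodule.coe_smul]
    exacts [z1, t1]
  have hs : CohenWales.g l r 1 (ψ (Y 0 2) + ψ (Y 1 2)) = r • (ψ (Y 0 2) + ψ (Y 1 2)) := by
    rw [← map_add, ← map_smul]
    refine hg 1 _ _ ?_
    simp only [Y, Specht.g, Matrix.cons_val, Submodule.coe_add, Submodule.coe_smul, map_add, z3, z4]
    match_scalars <;> field_simp <;> ring
  have hd : CohenWales.g l r 0 (ψ (Y 0 2) - ψ (Y 1 2)) = r • (ψ (Y 0 2) - ψ (Y 1 2)) := by
    rw [← map_sub, ← map_smul]
    refine hg 0 _ _ ?_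
    simp only [Y, Specht.g, Matrix.cons_val, Module.End.mul_apply, AddSubgroupClass.coe_sub,
      Submodule.coe_smul, map_sub, map_add, map_smul, map_neg, s2, s4, z3, z4]
    match_scalars <;> field_simp <;> ring
  have h20 : CohenWales.g l r 2 (ψ (Y 0 1)) =
      ((r - r⁻¹) / (1 + (r ^ 2)⁻¹)) • ψ (Y 0 1) +
        (r⁻¹ + (r - r⁻¹) / (1 + (r ^ 2)⁻¹)) • ψ (Y 0 2) := by
    rw [← map_smul, ← map_smul, ← map_add]
    exact hg 2 _ _ o1
  have h21 : CohenWales.g l r 2 (ψ (Y 0 2)) =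
      ((r - r⁻¹) / (1 + r ^ 2)) • ψ (Y 0 2) + (r⁻¹ + (r - r⁻¹) / (1 + r ^ 2)) • ψ (Y 0 1) := by
    rw [← map_smul, ← map_smul, ← map_add]
    exact hg 2 _ _ o3
  refine hψ (Y 0 1) (fun h => hne (congrArg Subtype.val h))
    (hv.eq_zero_of_neg_neg_pos hl hr hr2 ?_ ?_)
  · rw [h20, map_add, map_smul, map_smul, h20, h21]
    match_scalars <;> rw [m] <;> field_simp <;> ring
  · have hf := eigenform_g (l := l) (α := -r⁻¹) (β := -r⁻¹) (γ := r) hr (Or.inr rfl)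
      (Or.inr rfl) (Or.inl rfl) (Or.inl rfl)
    generalize eigenform (K := K) _ _ _ = f at hf ⊢
    have f1 : f (ψ (Y 0 2)) = 0 :=
      eq_zero_of_add_of_sub f (eq_zero_of_eigenvalue_ne (fun v => (hf v).2.1) hs hn)
        (eq_zero_of_eigenvalue_ne (fun v => (hf v).1) hd hn)
    rw [h20]
    simp only [map_add, map_smul, smul_eq_mul, f1]
    field_simp
    ring

/-- For `l = 1 / r`, the subspaces `𝒰` and `𝒲` are isomorphic to `S^{(2,2)+}` and `S^{(2,2)-}`. -/
theorem areIsomorphicSubspaces_subspaceUW [CharZero K] {r : K} (hr : r ≠ 0)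
    (hr1 : r ^ 2 ≠ 1) (hr2 : r ^ 2 ≠ -1) (hr4 : r ^ 4 ≠ -1) (ε : ℤˣ) :
    AreIsomorphicSubspaces (CohenWales.g r⁻¹ r) (subspaceUW r ε)
      (Specht.g r (shapes fun _ => false)) (half K (shape false) ε) := by
  obtain ⟨y, hy, h2, hrange⟩ := exists_isReflectionTriple hr hr2 hr4 ε
  have hz := isReflectionTriple_rowTriple hr hr1 hr2 ε
  rw [← hrange, ← range_rowTriple hr hr1 hr2 hr4]
  exact hy.areIsomorphicSubspaces_range hz (hy.injective (fold_surjective ε) h2 hr hr2 hr4)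
    (hz.injective (fold_surjective ε) (halfVec_ne_zero false ε).2 hr hr2 hr4)

end

theorem mainTheorem7 {K : Type*} [Field K] [CharZero K] (l r : K) (hl : l ≠ 0) (hr : r ≠ 0)
    (hss : ∀ k : ℕ, 1 ≤ k → k ≤ 3 → r ^ (2 * k) ≠ 1 ∧ r ^ (2 * k) ≠ -1) (hss' : r ^ 8 ≠ 1) :
    -- occurrence and uniqueness of the two modules `S^{(2,2)±}`
    (∀ ε : ℤˣ,
      ((∃ X : Submodule K (CWSpace K),
          IsIrreducibleSubspace (CohenWales.g l r) X ∧ Module.finrank K X = 3 ∧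
          AreIsomorphicSubspaces (CohenWales.g l r) X
            (Specht.g r (Specht.row₂, Specht.row₂)) (Specht.half K Specht.row₂ ε)) ↔
        l = 1 / r) ∧
      (l = 1 / r →
        ∃! X : Submodule K (CWSpace K),
          IsIrreducibleSubspace (CohenWales.g l r) X ∧ Module.finrank K X = 3 ∧
          AreIsomorphicSubspaces (CohenWales.g l r) X
            (Specht.g r (Specht.row₂, Specht.row₂)) (Specht.half K Specht.row₂ ε))) ∧
    -- the decomposition of the span of the `t_{ij}`
    (l = 1 / r →
      IsInvariantSubspace (CohenWales.g l r) (CohenWales.subspaceT K) ∧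
      Module.finrank K (CohenWales.subspaceT K) = 6 ∧
      IsIrreducibleSubspace (CohenWales.g l r) (CohenWales.subspaceU r) ∧
      Module.finrank K (CohenWales.subspaceU r) = 3 ∧
      IsIrreducibleSubspace (CohenWales.g l r) (CohenWales.subspaceW r) ∧
      Module.finrank K (CohenWales.subspaceW r) = 3 ∧
      CohenWales.subspaceU r ⊓ CohenWales.subspaceW r = ⊥ ∧
      CohenWales.subspaceU r ⊔ CohenWales.subspaceW r = CohenWales.subspaceT K) ∧
    -- the modules `S^{(1²,1²)±}` do not occur
    (∀ ε : ℤˣ, ¬ ∃ X : Submodule K (CWSpace K),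
      AreIsomorphicSubspaces (CohenWales.g l r) X
        (Specht.g r (Specht.column₂, Specht.column₂)) (Specht.half K Specht.column₂ ε)) ∧
    -- the module `S^{(1,1),(2)}` does not occur
    (¬ ∃ X : Submodule K (CWSpace K),
      AreIsomorphicSubspaces (CohenWales.g l r) X
        (Specht.g r (Specht.column₂, Specht.row₂)) ⊤) := by
  have hr1 : r ^ 2 ≠ 1 := (hss 1 le_rfl (by norm_num)).1
  have hr2 : r ^ 2 ≠ -1 := (hss 1 le_rfl (by norm_num)).2
  have hr4 : r ^ 4 ≠ -1 := (hss 2 (by norm_num) (by norm_num)).2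
  have hrow (X : Submodule K (CWSpace K)) (ε : ℤˣ) (H : AreIsomorphicSubspaces (CohenWales.g l r) X
      (Specht.g r (Specht.row₂, Specht.row₂)) (Specht.half K Specht.row₂ ε)) :=
    eq_one_div_and_exists_mem_of_row hl hr hr1 hr2 hr4 H
  have hUW (h : l = 1 / r) (ε : ℤˣ) :
      IsIrreducibleSubspace (CohenWales.g l r) (CohenWales.subspaceUW r ε) ∧
        Module.finrank K (CohenWales.subspaceUW r ε) = 3 ∧
        AreIsomorphicSubspaces (CohenWales.g l r) (CohenWales.subspaceUW r ε)
          (Specht.g r (Specht.row₂, Specht.row₂)) (Specht.half K Specht.row₂ ε) := by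
    rw [one_div] at h
    subst h
    exact ⟨CohenWales.isIrreducibleSubspace_subspaceUW hr hr2 hr4 ε,
      CohenWales.finrank_subspaceUW hr hr2 hr4 ε,
      areIsomorphicSubspaces_subspaceUW hr hr1 hr2 hr4 ε⟩
  refine ⟨fun ε => ⟨⟨fun ⟨X, _, _, hX⟩ => (hrow X ε hX).1, fun h => ⟨_, hUW h ε⟩⟩,
    fun h => ⟨_, hUW h ε, ?_⟩⟩, fun h => ?_, fun ε ⟨X, hX⟩ =>
    not_areIsomorphicSubspaces_column hl hr hr1 hr2 hr4 ε X hX, fun ⟨X, hX⟩ =>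
    not_areIsomorphicSubspaces_column_row hl hr hr1 hr2 X hX⟩
  · rintro X ⟨hirr, -, hX⟩
    obtain ⟨-, v, hv, hv', hne⟩ := hrow X ε hX
    exact hirr.eq_of_mem (hUW h ε).1 hv hv' hne
  · have hU := hUW h 1
    have hW := hUW h (-1)
    rw [CohenWales.subspaceUW_one] at hU
    rw [CohenWales.subspaceUW_neg_one] at hW
    obtain ⟨hsup, hT⟩ := CohenWales.subspaceU_sup_subspaceW hr hr2 hr4
    refine ⟨?_, hT, hU.1, hU.2.1, hW.1, hW.2.1, CohenWales.subspaceU_inf_subspaceW hr hr2 hr4, hsup⟩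
    rw [← hsup]
    intro i v hv
    obtain ⟨u, hu, w, hw, rfl⟩ := Submodule.mem_sup.mp hv
    rw [map_add]
    exact Submodule.add_mem_sup (hU.1.1 i u hu) (hW.1.1 i w hw)
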